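/- Let $\delta>0$, let $X$ be a $\delta$-hyperbolic length space (four-point condition $\langle x,z\rangle_t\ge\min\{\langle x,y\rangle_t,\langle y,z\rangle_t\}-\delta$), and let $G$ be a group acting on $X$ acylindrically by isometries. Definitions. For $H\le G$, $\partial H\subseteq\partial X$ is the set of accumulation points of an $H$-orbit. $H$ is elementary if $|\partial H|\le 2$ and elliptic if its orbits are bounded; $g\in G$ is loxodromic if $|\partial\langle g\rangle|=2$, and then $E(g)$ denotes the setwise stabilizer of $\partial\langle g\rangle$ in $G$. The action is tame if $G$ has no subgroup of order $4$ and, for every loxodromic $g$, the maximal finite normal subgroup of $E(g)$ has order at most $2$. Let $\nu=\nu(G,X)$ be the smallest positive integer $m$ such that for all $g,h\in G$ with $h$ loxodromic, if $g,h^{-1}gh,\dots,h^{-m}gh^m$ generate an elliptic subgroup then $g,h$ generate an elementary subgroup ($\nu=\infty$ if there is no such $m$); when $\nu<\infty$ put $\tau=\max\{\nu,3\}$. Put $[g]=\inf_{x\in X}d(x,gx)$, $A_g=\{x\in X: d(x,gx)<[g]+8\delta\}$, and $A(g_0,\dots,g_m)=\operatorname{diam}\bigl(A_{g_0}^{+13\delta}\cap\dots\cap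 A_{g_m}^{+13\delta}\bigr)\in[0,\infty]$, where $Y^{+\alpha}$ is the closed $\alpha$-neighbourhood of $Y$. For $l_0\ge 0$ let $L(l_0,\delta)$ be the infimum of the $L>0$ such that in every $\delta$-hyperbolic length space, for all $0\le l\le l_0$, every $L$-local $(1,l)$-quasi-geodesic $\gamma:I\to X$ (parametrized by arc length on a closed interval $I$) satisfies: (i) $\gamma$ is a $(2,l)$-quasi-geodesic; (ii) $\langle\gamma(t),\gamma(t')\rangle_{\gamma(s)}\le l/2+5\delta$ for $t\le s\le t'$ in $I$; (iii) $d(x,\gamma)\le\langle y,y'\rangle_x+l+8\delta$ for $x\in X$ and $y,y'\in\gamma$; (iv) $\gamma$ is at Hausdorff distance at most $2l+5\delta$ from every $L$-local $(1,l)$-quasi-geodesic with the same endpoints (possibly in $\partial X$). Let $L_S$ be the smallest integer larger than $500$ with $L(10^5\delta,\delta)\le L_S\delta$. When $\nu<\infty$, let $\Omega=\Omega(G,X)\in[0,\infty]$ be the supremum of $A(g_0,\dots,g_\tau)$ over all $(\tau+1)$-tuples of elements of $G$ that generate a non-elementary subgroup and satisfy $[g_j]\le L_S\delta$ for all $j$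 ($\Omega=0$ if there are none). Statement. Suppose that the action is tame and $\nu(G,X)<\infty$. (a) Let $g,h\in G$ with $h$ loxodromic and let $m\ge\tau$ be an integer such that $g,h^{-1}gh,\dots,h^{-m}gh^m$ generate an elementary subgroup. Then $g$ and $h$ generate an elementary subgroup. (b) Let $g,h\in G$ generate a non-elementary subgroup. If $[g]\le L_S\delta$, then $A(g,h)\le\tau[h]+\Omega+154\delta$. In general, $$A(g,h)\le[g]+[h]+\tau\max\{[g],[h]\}+\Omega+680\delta.$$ (c) Let $0\le m\le\tau$ and let $g_0,\dots,g_m\in G$ generate a non-elementary subgroup. Then $$A(g_0,\dots,g_m)\le(\tau+2)\max\{[g_0],\dots,[g_m]\}+\Omega+680\delta.$$ -/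

import Mathlib

open Filter Topology
open scoped ENNReal Pointwise

universe u v

noncomputable section

namespace HypAct

/-! ### Hyperbolic length spaces -/

section Spaces

variable {X : Type u} [MetricSpace X]

/-- The Gromov product of `x` and `y` with respect to `z`. -/
def gromovProd (z x y : X) : ℝ := (dist x z + dist y z - dist x y) / 2

/-- `X` is `δ`-hyperbolic in the sense of Gromov (four point condition). -/
def IsHyperbolic (δ : ℝ) (X : Type u) [MetricSpace X] : Prop :=
  ∀ x y z t : X, min (gromovProd t x y) (gromovProd t y z) - δ ≤ gromovProd t x z

/-- `X` is a length space: the distance between two points is the infimum of the lengths of the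
continuous paths joining them. -/
def IsLengthSpace (X : Type u) [MetricSpace X] : Prop :=
  ∀ x y : X, ⨅ γ : Path x y, eVariationOn (⇑γ) Set.univ = edist x y

/-! ### The boundary at infinity -/

/-- The sequence `y` converges to infinity: the Gromov products of `y m` and `y m'` tend to `+∞`
as `m` and `m'` tend to infinity. -/
def ConvergesToInfinity (y : ℕ → X) : Prop :=
  ∀ o : X, Tendsto (fun p : ℕ × ℕ => gromovProd o (y p.1) (y p.2)) atTop atTop

/-- The sequences of points of `X` which converge to infinity. -/
def InfSeq (X : Type u) [MetricSpace X] : Type u := {y : ℕ → X // ConvergesToInfinity y}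

/-- Two sequences converging to infinity are related if their Gromov product tends to infinity. -/
def InfSeq.Rel (y z : InfSeq X) : Prop :=
  ∀ o : X, Tendsto (fun n : ℕ => gromovProd o (y.1 n) (z.1 n)) atTop atTop

/-- The boundary at infinity of `X`: the quotient of the set of sequences converging to infinity
by the relation `InfSeq.Rel` (which is an equivalence relation when `X` is hyperbolic). -/
def Boundary (X : Type u) [MetricSpace X] : Type u := Quot (InfSeq.Rel (X := X))

/-- `∂Y`: the points of the boundary which are limits of sequences of points of `Y`. -/
def boundaryOf (Y : Set X) : Set (Boundary X) :=
  {ξ | ∃ y : InfSeq X, (∀ n, y.1 n ∈ Y) ∧ Quot.mk _ y = ξ}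

/-! ### Quasi-geodesics and the constant `L_S` -/

/-- The restriction of `γ` to `I` is a `(k, l)`-quasi-isometric embedding. -/
def IsQIEmbOn (k l : ℝ) (γ : ℝ → X) (I : Set ℝ) : Prop :=
  ∀ s ∈ I, ∀ t ∈ I,
    1 / k * dist (γ s) (γ t) - l ≤ dist s t ∧ dist s t ≤ k * dist (γ s) (γ t) + l

/-- `γ : I → X` is an `L`-local `(k, l)`-quasi-geodesic. Here `I` is a (non-empty, closed, possibly
unbounded) interval, `γ` is parametrized by arc length, and its restriction to any subset of
diameter at most `L` is a `(k, l)`-quasi-isometric embedding. -/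
structure IsLocalQuasiGeodesic (L k l : ℝ) (γ : ℝ → X) (I : Set ℝ) : Prop where
  nonempty : I.Nonempty
  isClosed : IsClosed I
  ordConnected : I.OrdConnected
  arcLength : HasUnitSpeedOn γ I
  qi : ∀ J ⊆ I, Bornology.IsBounded J → Metric.diam J ≤ L → IsQIEmbOn k l γ J

/-- `e` is the initial endpoint of `γ : I → X`, a point of `X` if `I` has a least element and a
point of the boundary at infinity if `I` is unbounded below. -/
def IsInitialEnd (γ : ℝ → X) (I : Set ℝ) : X ⊕ Boundary X → Prop
  | .inl p => ∃ a, IsLeast I a ∧ γ a = p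
  | .inr ξ => ¬ BddBelow I ∧ ∃ y : InfSeq X, (∀ n : ℕ, y.1 n = γ (-(n : ℝ))) ∧ Quot.mk _ y = ξ

/-- `e` is the terminal endpoint of `γ : I → X`, a point of `X` if `I` has a greatest element and a
point of the boundary at infinity if `I` is unbounded above. -/
def IsTerminalEnd (γ : ℝ → X) (I : Set ℝ) : X ⊕ Boundary X → Prop
  | .inl p => ∃ b, IsGreatest I b ∧ γ b = p
  | .inr ξ => ¬ BddAbove I ∧ ∃ y : InfSeq X, (∀ n : ℕ, y.1 n = γ (n : ℝ)) ∧ Quot.mk _ y = ξ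

end Spaces

/-- The number `L` is good for `l₀` and `δ`: in every `δ`-hyperbolic length space and for every
`0 ≤ l ≤ l₀`, each `L`-local `(1, l)`-quasi-geodesic `γ : I → X` has the four properties expressing
the stability of quasi-geodesics. -/
def IsStabilityValue (l₀ δ L : ℝ) : Prop :=
  ∀ (X : Type u) [MetricSpace X], IsHyperbolic δ X → IsLengthSpace X →
    ∀ (l : ℝ), 0 ≤ l → l ≤ l₀ → ∀ (γ : ℝ → X) (I : Set ℝ), IsLocalQuasiGeodesic L 1 l γ I →
      IsQIEmbOn 2 l γ I ∧
      (∀ t ∈ I, ∀ s ∈ I, ∀ t' ∈ I, t ≤ s → s ≤ t' →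
        gromovProd (γ s) (γ t) (γ t') ≤ l / 2 + 5 * δ) ∧
      (∀ x : X, ∀ y ∈ γ '' I, ∀ y' ∈ γ '' I,
        Metric.infDist x (γ '' I) ≤ gromovProd x y y' + l + 8 * δ) ∧
      (∀ (γ' : ℝ → X) (I' : Set ℝ), IsLocalQuasiGeodesic L 1 l γ' I' →
        ∀ e e' : X ⊕ Boundary X, IsInitialEnd γ I e → IsInitialEnd γ' I' e →
          IsTerminalEnd γ I e' → IsTerminalEnd γ' I' e' →
          Metric.hausdorffEDist (γ '' I) (γ' '' I') ≤ ENNReal.ofReal (2 * l + 5 * δ))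

/-- `L(l₀, δ)`: the best value (infimum) of the positive numbers good for `l₀` and `δ`. The
infimum is taken in `[0, ∞]`. -/
def bestL (l₀ δ : ℝ) : ℝ≥0∞ :=
  ⨅ (L : ℝ) (_ : 0 < L) (_ : IsStabilityValue.{u} l₀ δ L), ENNReal.ofReal L

/-- The constant `L_S`: the smallest integer larger than `500` such that
`L(10⁵ δ, δ) ≤ L_S δ`. By rescaling, it does not depend on `δ > 0`. -/
def LS (δ : ℝ) : ℕ∞ :=
  ⨅ (n : ℕ) (_ : 500 < n) (_ : bestL.{u} (10 ^ 5 * δ) δ ≤ ENNReal.ofReal (n * δ)), (n : ℕ∞)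

/-! ### Group actions -/

section Actions

variable {G : Type v} [Group G] {X : Type u} [MetricSpace X] [MulAction G X] [IsIsometricSMul G X]

lemma gromovProd_smul (g : G) (o x y : X) :
    gromovProd o (g • x) (g • y) = gromovProd (g⁻¹ • o) x y := by
  have h : ∀ z : X, dist (g • z) o = dist z (g⁻¹ • o) := fun z => by
    rw [← dist_smul g z (g⁻¹ • o), smul_inv_smul]
  simp only [gromovProd, h, dist_smul]

/-- The translate of a sequence converging to infinity. -/
def InfSeq.smul (g : G) (y : InfSeq X) : InfSeq X :=
  ⟨fun n => g • y.1 n, fun o => by simpa only [gromovProd_smul] using y.2 (g⁻¹ • o)⟩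

/-- The action on the boundary: `g • [(x_m)] = [(g • x_m)]`. -/
instance : MulAction G (Boundary X) where
  smul g := Quot.map (InfSeq.smul g) fun y z h o => by
    simpa only [InfSeq.smul, gromovProd_smul] using h (g⁻¹ • o)
  one_smul ξ := by
    induction ξ using Quot.ind with
    | _ y => exact congrArg (Quot.mk _) (Subtype.ext (funext fun n => one_smul G (y.1 n)))
  mul_smul a b ξ := by
    induction ξ using Quot.ind with
    | _ y => exact congrArg (Quot.mk _) (Subtype.ext (funext fun n => mul_smul a b (y.1 n)))

variable (X)

/-- `∂H`: the set of accumulation points in the boundary of an orbit `H • x` (it does not depend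
on the base point `x`). -/
def limitSet (H : Subgroup G) : Set (Boundary X) :=
  ⋃ x : X, boundaryOf {y | ∃ h ∈ H, y = h • x}

/-- A subgroup is elementary if its limit set has at most two points. -/
def IsElementary (H : Subgroup G) : Prop := (limitSet X H).encard ≤ 2

/-- A subgroup is elliptic if its orbits are bounded. -/
def IsElliptic (H : Subgroup G) : Prop :=
  ∀ x : X, Bornology.IsBounded {y | ∃ h ∈ H, y = h • x}

/-- An element `g` is loxodromic if the limit set of `⟨g⟩` has exactly two points. -/
def IsLoxodromic (g : G) : Prop := (limitSet X (Subgroup.zpowers g)).encard = 2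

/-- For `g` loxodromic, `E(g)` is the setwise stabilizer of the limit set of `⟨g⟩`, the maximal
loxodromic subgroup containing `g`. -/
def maxLoxodromic (g : G) : Subgroup G :=
  MulAction.stabilizer G (limitSet X (Subgroup.zpowers g))

variable (G)

/-- The action of `G` on `X` is acylindrical. -/
def IsAcylindrical : Prop :=
  ∀ ε : ℝ, 0 ≤ ε → ∃ (M : ℕ) (L : ℝ), 0 < M ∧ 0 < L ∧ ∀ x y : X, L ≤ dist x y →
    {g : G | dist x (g • x) ≤ ε ∧ dist y (g • y) ≤ ε}.encard ≤ M

/-- The action of `G` on `X` is tame: `G` has no subgroup of order `4` and, for `g` loxodromic, the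
maximal normal finite subgroup of `E(g)` has order at most `2`, that is, all finite normal
subgroups of `E(g)` have order at most `2`. -/
def IsTame : Prop :=
  (∀ K : Subgroup G, Nat.card K ≠ 4) ∧
  ∀ g : G, IsLoxodromic X g →
    ∀ F : Subgroup (maxLoxodromic X g), F.Normal → Finite F → Nat.card F ≤ 2

/-- The defining property of `ν`: if `h` is loxodromic and `g, h⁻¹gh, …, h⁻ᵐghᵐ` generate an
elliptic subgroup, then `g` and `h` generate an elementary subgroup. -/
def NuProperty (m : ℕ) : Prop :=
  ∀ g h : G, IsLoxodromic X h →
    IsElliptic X (Subgroup.closure (Set.range fun i : Fin (m + 1) =>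
      (h ^ (i : ℕ))⁻¹ * g * h ^ (i : ℕ))) →
    IsElementary X (Subgroup.closure {g, h})

/-- The invariant `ν(G, X)`: the smallest positive integer with `NuProperty`, and `⊤` (that is, `∞`)
if there is none. -/
def nu : ℕ∞ := ⨅ (m : ℕ) (_ : 0 < m) (_ : NuProperty G X m), (m : ℕ∞)

/-- The invariant `τ(G, X) = max {ν(G, X), 3}`, for actions with `ν(G, X)` finite. -/
def tau : ℕ := max (nu G X).toNat 3

variable {G}

/-- The translation length `[g]`. -/
def transLength (g : G) : ℝ := ⨅ x : X, dist x (g • x)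

/-- The axis `A_g`. -/
def axis (δ : ℝ) (g : G) : Set X := {x | dist x (g • x) < transLength X g + 8 * δ}

/-- `A(g₀, …, g_m)`: the diameter, in `[0, ∞]`, of the intersection of the closed
`13δ`-neighbourhoods of the axes. -/
def overlap (δ : ℝ) {m : ℕ} (g : Fin m → G) : ℝ≥0∞ :=
  Metric.ediam (⋂ j, Metric.cthickening (13 * δ) (axis X δ (g j)))

/-- The condition `[g] ≤ L_S δ`. -/
def IsShort (δ : ℝ) (g : G) : Prop :=
  ENNReal.ofReal (transLength X g) ≤ (LS.{u} δ : ℝ≥0∞) * ENNReal.ofReal δ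

variable (G)

/-- `Ω(G, X)`: the supremum in `[0, ∞]` of `A(g₀, …, g_τ)` over all `(τ + 1)`-tuples which generate
a non-elementary subgroup and satisfy `[g_j] ≤ L_S δ` for all `j`. -/
def Omega (δ : ℝ) : ℝ≥0∞ :=
  ⨆ (g : Fin (tau G X + 1) → G) (_ : ¬ IsElementary X (Subgroup.closure (Set.range g)))
    (_ : ∀ j, IsShort X δ (g j)), overlap X δ g

end Actions

end HypAct

end

/-!
The geometric input is that in a `δ`-hyperbolic length space the displacements `a n = d(x, gⁿ x)`
are controlled by the translation length `[g]`: one has `a 2 ≤ a 1 + [g] + 2 δ` for every isometry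
(`IsHyperbolic.dist_sq_smul_le`), and, if `[g] > 10 δ`, `a (n + 1) ≥ a n + [g] - 6 δ` and
`a k + a l ≤ a (k + l) + (a 1 - [g]) + 8 δ` (`IsHyperbolic.le_dist_pow_succ_smul`,
`IsHyperbolic.dist_pow_add_le`). Hence such an isometry, called long, is loxodromic, and axes are
quasi-convex (`IsHyperbolic.mem_cthickening_axis`). Of the constant `L_S` one only uses that it is
larger than `500`: an isometry which is not short is long. The stability of local quasi-geodesics
plays no role.

For the first statement, let `H` be generated by the conjugates of `g` by `1, h, …, hᵐ`. If `H` is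
elliptic, the definition of `ν` applies. Otherwise `H` contains a long isometry `u`, by
acylindricity (`IsAcylindrical.exists_long`), and `H` preserves the limit set of `u`. By
acylindricity again, some power of `u` is central and of finite index in the subgroup fixing both
limit points (`LongIsometry.exists_commute_pow`), so that the elements of finite order of this
subgroup form a finite subgroup (`LongIsometry.exists_torsion`), of order at most `2` by tameness.
If `g` has infinite order, or if it is an involution exchanging the limit points, then `g ^ 2`,
respectively the product of `g` and `h⁻¹ g h`, has infinite order and fixes the limit points of
`u`, as does its conjugate by `h`; therefore `h` preserves the limit set of `u`. In the
remaining cases tameness shows that `H` is finite, contrary to the assumption.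

For the second statement, if `g` is short and `h` is long, most of the segment along which the two
axes run close to each other is moved by `1, h, …, h^τ` into a neighbourhood of the axis of `g`,
that is, lies close to the axes of the conjugates of `g`, which generate a non-elementary subgroup
by the first statement (`IsTame.overlap_le_of_isShort`). If `g` and `h` are both long, their
commutator almost fixes the middle of the segment, hence is short, and the previous case applies to
the commutator and `h` (`IsTame.overlap_le_of_long`). The third statement reduces to the second
one, because a tuple containing a long isometry `u` and generating a non-elementary subgroup
contains an element which does not preserve the limit set of `u` (`IsTame.overlap_le`).
-/

namespace HypAct

/-! ### Four points, Gromov products and almost geodesics -/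

section Geometry

variable {X : Type u} [MetricSpace X] {δ : ℝ}

lemma gromovProd_comm (o x y : X) : gromovProd o x y = gromovProd o y x := by
  unfold gromovProd; rw [dist_comm x y]; ring

lemma gromovProd_nonneg (o x y : X) : 0 ≤ gromovProd o x y := by
  unfold gromovProd; linarith [dist_triangle_right x y o]

lemma gromovProd_self (o x : X) : gromovProd o x x = dist x o := by
  unfold gromovProd; rw [dist_self]; ring

lemma le_gromovProd (o x y : X) : dist x o - dist x y ≤ gromovProd o x y := by
  unfold gromovProd; linarith [dist_triangle x y o]

lemma gromovProd_le_add_dist_base (o o' x y : X) :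
    gromovProd o x y ≤ gromovProd o' x y + dist o o' := by
  unfold gromovProd
  linarith [dist_triangle_right x o o', dist_triangle_right y o o']

lemma gromovProd_le_add_dist_left (o x x' y : X) :
    gromovProd o x y ≤ gromovProd o x' y + dist x x' := by
  unfold gromovProd
  linarith [dist_triangle x x' o, dist_triangle x' x y, dist_comm x x']

/-- The four point condition, in terms of the three ways of pairing off the points. -/
lemma IsHyperbolic.four_point (hX : IsHyperbolic δ X) (x y z t : X) :
    dist x z + dist y t ≤ dist x y + dist z t + 2 * δ ∨
      dist x z + dist y t ≤ dist y z + dist x t + 2 * δ := by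
  have h := hX x y z t
  unfold gromovProd at h
  rcases le_total ((dist x t + dist y t - dist x y) / 2) ((dist y t + dist z t - dist y z) / 2)
    with h' | h'
  · rw [min_eq_left h'] at h; left; linarith
  · rw [min_eq_right h'] at h; right; linarith

lemma IsHyperbolic.le_or_le_of_gromovProd_le (hX : IsHyperbolic δ X) {o x y z : X} {c : ℝ}
    (h : gromovProd o x z ≤ c) : gromovProd o x y ≤ c + δ ∨ gromovProd o y z ≤ c + δ := by
  rcases min_le_iff.1 (show min (gromovProd o x y) (gromovProd o y z) ≤ c + δ by
    linarith [hX x y z o]) with h | h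
  · exact .inl h
  · exact .inr h

/-- If `p` is almost between `x` and `y`, it is almost between any `x'` and `y'` such that the
Gromov products of `x, x'` and of `y, y'` at `p` are large. -/
lemma IsHyperbolic.gromovProd_le_of_lt (hX : IsHyperbolic δ X) (hδ : 0 < δ) {p x y x' y' : X}
    {c : ℝ} (h : gromovProd p x y ≤ c) (hx : c + 2 * δ < gromovProd p x x')
    (hy : c + 2 * δ < gromovProd p y y') : gromovProd p x' y' ≤ c + 2 * δ := by
  rcases hX.le_or_le_of_gromovProd_le (y := x') h with h1 | h1
  · linarith
  · rcases hX.le_or_le_of_gromovProd_le (y := y') h1 with h2 | h2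
    · linarith
    · rw [gromovProd_comm] at h2; linarith

/-- In a length space there are points almost on a geodesic from `x` to `y`, at any prescribed
distance from `x`. -/
lemma IsLengthSpace.exists_between (hX : IsLengthSpace X) (x y : X) {t η : ℝ} (ht : 0 ≤ t)
    (ht' : t ≤ dist x y) (hη : 0 < η) : ∃ w, dist x w = t ∧ dist w y ≤ dist x y - t + η := by
  have h1 : ⨅ γ : Path x y, eVariationOn (⇑γ) Set.univ < ENNReal.ofReal (dist x y + η) := by
    rw [hX x y, edist_dist]
    exact (ENNReal.ofReal_lt_ofReal_iff (by linarith [dist_nonneg (x := x) (y := y)])).2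
      (by linarith)
  obtain ⟨γ, hγ⟩ := iInf_lt_iff.1 h1
  obtain ⟨s, hs⟩ := mem_range_of_exists_le_of_exists_ge (c := t)
    (f := fun s => dist x (γ s)) (by fun_prop) ⟨0, by simpa using ht⟩ ⟨1, by simpa using ht'⟩
  refine ⟨γ s, hs, ?_⟩
  have h2 : edist x (γ s) + edist (γ s) y ≤ eVariationOn (⇑γ) Set.univ := by
    have ha := eVariationOn.edist_le (⇑γ) (s := Set.Iic s) (x := 0) (y := s)
      (Set.mem_Iic.2 s.2.1) (Set.mem_Iic.2 le_rfl)
    have hb := eVariationOn.edist_le (⇑γ) (s := Set.Ici s) (x := s) (y := 1)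
      (Set.mem_Ici.2 le_rfl) (Set.mem_Ici.2 s.2.2)
    rw [γ.source] at ha
    rw [γ.target] at hb
    exact (add_le_add ha hb).trans ((eVariationOn.add_le_union _ fun a ha b hb =>
      (Set.mem_Iic.1 ha).trans (Set.mem_Ici.1 hb)).trans
        (eVariationOn.mono _ (Set.subset_univ _)))
  have h3 := h2.trans_lt hγ
  rw [edist_dist, edist_dist, ← ENNReal.ofReal_add dist_nonneg dist_nonneg,
    ENNReal.ofReal_lt_ofReal_iff (by linarith [dist_nonneg (x := x) (y := y)])] at h3
  have h4 : dist x (γ s) = t := hs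
  linarith

end Geometry

/-! ### Translation lengths and axes -/

section Isometries

variable {G : Type v} [Group G] {X : Type u} [MetricSpace X] [MulAction G X] {δ : ℝ}

lemma transLength_nonneg (g : G) : 0 ≤ transLength X g :=
  Real.iInf_nonneg fun _ => dist_nonneg

lemma transLength_le (g : G) (x : X) : transLength X g ≤ dist x (g • x) :=
  ciInf_le ⟨0, by rintro _ ⟨y, rfl⟩; exact dist_nonneg⟩ x

lemma exists_dist_lt [Nonempty X] (g : G) {c : ℝ} (hc : transLength X g < c) :
    ∃ x : X, dist x (g • x) < c :=
  exists_lt_of_ciInf_lt hc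

lemma exists_mem_axis_of_mem_cthickening (hδ : 0 < δ) {g : G} {x : X}
    (hx : x ∈ Metric.cthickening (13 * δ) (axis X δ g)) : ∃ x' ∈ axis X δ g, dist x x' ≤ 14 * δ := by
  rw [Metric.mem_cthickening_iff] at hx
  obtain ⟨x', hx', h⟩ := Metric.infEDist_lt_iff.1 (hx.trans_lt
    ((ENNReal.ofReal_lt_ofReal_iff (q := 14 * δ) (by linarith)).2 (by linarith)))
  rw [edist_dist, ENNReal.ofReal_lt_ofReal_iff (by linarith)] at h
  exact ⟨x', hx', h.le⟩

variable [IsIsometricSMul G X]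

lemma dist_inv_smul_eq (g : G) (x : X) : dist x (g⁻¹ • x) = dist x (g • x) := by
  rw [← dist_smul g, smul_inv_smul, dist_comm]

lemma transLength_inv (g : G) : transLength X g⁻¹ = transLength X g := by
  simp only [transLength, dist_inv_smul_eq]

lemma transLength_conj (g h : G) : transLength X (h⁻¹ * g * h) = transLength X g := by
  unfold transLength
  refine (MulAction.toPerm (β := X) h).surjective.iInf_congr _ fun x => ?_
  rw [MulAction.toPerm_apply, mul_smul, mul_smul, ← dist_smul h x, smul_inv_smul]

lemma axis_inv (g : G) : axis X δ g⁻¹ = axis X δ g := by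
  simp only [axis, transLength_inv, dist_inv_smul_eq]

lemma dist_pow_smul_pow_add_smul (g : G) (x : X) (m k : ℕ) :
    dist (g ^ m • x) (g ^ (m + k) • x) = dist x (g ^ k • x) := by
  rw [pow_add, mul_smul, dist_smul]

lemma dist_pow_smul_le (g : G) (x : X) (n : ℕ) : dist x (g ^ n • x) ≤ n * dist x (g • x) := by
  induction n with
  | zero => simp
  | succ n ih =>
    have h := dist_pow_smul_pow_add_smul g x n 1
    rw [pow_one] at h
    push_cast
    linarith [dist_triangle x (g ^ n • x) (g ^ (n + 1) • x)]

lemma transLength_pow_le [Nonempty X] (g : G) (n : ℕ) :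
    transLength X (g ^ n) ≤ n * transLength X g := by
  rcases n.eq_zero_or_pos with rfl | hn
  · obtain ⟨x⟩ := ‹Nonempty X›
    simpa using transLength_le (1 : G) x
  · have hn' : (0 : ℝ) < n := by exact_mod_cast hn
    rw [mul_comm, ← div_le_iff₀ hn']
    refine le_ciInf fun x => ?_
    rw [div_le_iff₀ hn', mul_comm]
    exact (transLength_le _ x).trans (dist_pow_smul_le g x n)

lemma IsHyperbolic.dist_pow_growth (hX : IsHyperbolic δ X) (g : G) (x : X) {ε : ℝ} (hε : 0 < ε)
    (h : dist x (g • x) + 2 * δ + ε ≤ dist x (g ^ 2 • x)) (h1 : 0 ≤ δ) (n : ℕ) :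
    dist x (g ^ (n + 1) • x) + ε ≤ dist x (g ^ (n + 2) • x) := by
  induction n with
  | zero => simp only [zero_add, pow_one]; linarith
  | succ n ih =>
    have e1 := dist_pow_smul_pow_add_smul g x 1 (n + 2)
    have e2 := dist_pow_smul_pow_add_smul g x 2 (n + 1)
    have e3 := dist_pow_smul_pow_add_smul g x 1 1
    rw [show 1 + (n + 2) = n + 1 + 2 by ring] at e1
    rw [show 2 + (n + 1) = n + 1 + 2 by ring] at e2
    rw [show 1 + 1 = 2 by norm_num] at e3
    rw [pow_one] at e1 e3
    rw [show n + 1 + 1 = n + 2 by ring]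
    rcases hX.four_point x (g • x) (g ^ 2 • x) (g ^ (n + 1 + 2) • x) with h' | h' <;> linarith

/-- The displacement of `g ^ 2` exceeds that of `g` by at most the translation length: otherwise
`n ↦ d(x, gⁿ x)` would grow too fast. -/
lemma IsHyperbolic.dist_sq_smul_le (hX : IsHyperbolic δ X) (hδ : 0 < δ) (g : G) (x : X) :
    dist x (g ^ 2 • x) ≤ dist x (g • x) + transLength X g + 2 * δ := by
  by_contra! hlt
  have : Nonempty X := ⟨x⟩
  set ε := dist x (g ^ 2 • x) - dist x (g • x) - 2 * δ with hε
  have hε' : transLength X g < ε := by linarith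
  have hε0 : 0 < ε := (transLength_nonneg g).trans_lt hε'
  obtain ⟨r, hr⟩ := exists_dist_lt g hε'
  have hgrow : ∀ n : ℕ, n * ε ≤ dist x (g ^ (n + 1) • x) := by
    intro n
    induction n with
    | zero => simp
    | succ n ih =>
      have := hX.dist_pow_growth g x hε0 (by linarith) hδ.le n
      push_cast
      rw [show n + 1 + 1 = n + 2 by ring]
      linarith
  obtain ⟨n, hn⟩ := exists_nat_gt ((dist r (g • r) + 2 * dist x r) / (ε - dist r (g • r)))
  rw [div_lt_iff₀ (by linarith)] at hn
  have h1 := hgrow n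
  have h2 := dist_pow_smul_le g r (n + 1)
  have h3 := dist_triangle4 x r (g ^ (n + 1) • r) (g ^ (n + 1) • x)
  rw [dist_smul, dist_comm r x] at h3
  push_cast at h2
  linarith

/-- Moving from `x` by `s` towards `g x` shortens the displacement by `g` by up to `2 s`. -/
lemma IsHyperbolic.dist_smul_le_of_between (hX : IsHyperbolic δ X) (g : G) {x q : X} {s η : ℝ}
    (hq : dist x q = s) (hq' : dist q (g • x) ≤ dist x (g • x) - s + η) :
    dist q (g • q) ≤ 2 * s - dist x (g • x) + 2 * δ ∨
      dist q (g • q) ≤ dist x (g • x) - 2 * s + 4 * δ + 2 * η ∨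
      dist q (g • q) ≤ dist x (g ^ 2 • x) - dist x (g • x) + 4 * δ + η := by
  have e1 : dist (g • x) (g • q) = s := by rw [dist_smul, hq]
  have e2 : dist (g • q) (g ^ 2 • x) = dist q (g • x) := by rw [pow_two, mul_smul, dist_smul]
  have e3 : dist (g • x) (g ^ 2 • x) = dist x (g • x) := by rw [pow_two, mul_smul, dist_smul]
  have c1 := dist_comm (g • q) x
  have c2 := dist_comm (g • q) (g • x)
  have c3 := dist_comm (g • x) x
  have c4 := dist_comm q x
  rcases hX.four_point q x (g • q) (g • x) with h | h
  · left; linarith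
  · rcases hX.four_point (g • q) (g • x) x (g ^ 2 • x) with h' | h'
    · right; right; linarith
    · right; left; linarith

lemma IsHyperbolic.le_dist_sq_smul (hX : IsHyperbolic δ X) (hlen : IsLengthSpace X)
    (g : G) (x : X) (hg : 4 * δ < transLength X g) :
    dist x (g • x) + transLength X g - 4 * δ ≤ dist x (g ^ 2 • x) := by
  by_contra! hlt
  obtain ⟨η, hη, hη'⟩ := exists_between (show 0 < min (transLength X g - 4 * δ)
    (dist x (g • x) + transLength X g - 4 * δ - dist x (g ^ 2 • x)) from
      lt_min (by linarith) (by linarith))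
  have h1 := hη'.trans_le (min_le_left _ _)
  have h2 := hη'.trans_le (min_le_right _ _)
  have h0 := dist_nonneg (x := x) (y := g • x)
  obtain ⟨q, hq, hq'⟩ := hlen.exists_between x (g • x) (t := dist x (g • x) / 2) (η := η / 2)
    (by linarith) (by linarith) (by linarith)
  have h := hX.dist_smul_le_of_between g hq hq'
  have h3 := transLength_le g q
  have h4 : 0 ≤ δ := by
    have := hX x x x x
    simp only [gromovProd, dist_self] at this
    norm_num at this
    linarith
  rcases h with h | h | h <;> linarith

/-- For an isometry with large translation length, `n ↦ d(x, gⁿ x)` grows linearly, for every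
point `x`. -/
lemma IsHyperbolic.le_dist_pow_succ_smul (hX : IsHyperbolic δ X) (hlen : IsLengthSpace X)
    (hδ : 0 < δ) (g : G) (x : X) (hg : 10 * δ < transLength X g) (n : ℕ) :
    dist x (g ^ n • x) + (transLength X g - 6 * δ) ≤ dist x (g ^ (n + 1) • x) := by
  rcases n with _ | n
  · simp only [pow_zero, one_smul, dist_self, zero_add, pow_one]
    linarith [transLength_le g x]
  · exact hX.dist_pow_growth g x (by linarith)
      (by linarith [hX.le_dist_sq_smul hlen g x (by linarith)]) hδ.le n

lemma IsHyperbolic.le_dist_pow_smul (hX : IsHyperbolic δ X) (hlen : IsLengthSpace X)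
    (hδ : 0 < δ) (g : G) (x : X) (hg : 10 * δ < transLength X g) (n : ℕ) :
    n * (transLength X g - 6 * δ) ≤ dist x (g ^ n • x) := by
  induction n with
  | zero => simp
  | succ n ih =>
    push_cast
    linarith [hX.le_dist_pow_succ_smul hlen hδ g x hg n]

/-- For an isometry with large translation length, the orbit of any point under the powers is
almost geodesic. -/
lemma IsHyperbolic.dist_pow_add_le (hX : IsHyperbolic δ X) (hlen : IsLengthSpace X)
    (hδ : 0 < δ) (g : G) (x : X) (hg : 10 * δ < transLength X g) (k l : ℕ) :
    dist x (g ^ k • x) + dist x (g ^ l • x) ≤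
      dist x (g ^ (k + l) • x) + (dist x (g • x) - transLength X g) + 8 * δ := by
  rcases l with _ | l
  · simp only [pow_zero, one_smul, dist_self, add_zero]
    linarith [transLength_le g x]
  have e1 := dist_pow_smul_pow_add_smul g x k (l + 1)
  have e2 := dist_pow_smul_pow_add_smul g x (k + 1) l
  have e3 := dist_pow_smul_pow_add_smul g x k 1
  rw [show k + 1 + l = k + (l + 1) by ring] at e2
  rw [pow_one] at e3
  have h1 := hX.le_dist_pow_succ_smul hlen hδ g x hg k
  have h2 := hX.le_dist_pow_succ_smul hlen hδ g x hg l
  rcases hX.four_point x (g ^ k • x) (g ^ (k + 1) • x) (g ^ (k + (l + 1)) • x) with h | h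
  · linarith
  · linarith

/-- A point whose displacement is close to the translation length is close to the axis. -/
lemma IsHyperbolic.exists_mem_axis (hX : IsHyperbolic δ X) (hlen : IsLengthSpace X)
    (hδ : 0 < δ) (g : G) (p : X) {r : ℝ} (hr : 0 ≤ r)
    (hp : dist p (g • p) < transLength X g + 2 * r + 4 * δ) :
    ∃ q ∈ axis X δ g, dist p q ≤ r := by
  obtain ⟨η, hη, hη'⟩ := exists_between (show 0 < min δ
    (transLength X g + 2 * r + 4 * δ - dist p (g • p)) from lt_min hδ (by linarith))
  have h1 := hη'.trans_le (min_le_left _ _)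
  have h2 := hη'.trans_le (min_le_right _ _)
  have h0 := dist_nonneg (x := p) (y := g • p)
  have hT := hX.dist_sq_smul_le hδ g p
  have hg := transLength_nonneg (X := X) g
  obtain ⟨q, hq, hq'⟩ := hlen.exists_between p (g • p) (t := min r (dist p (g • p) / 2))
    (η := η / 2) (le_min hr (by linarith)) ((min_le_right _ _).trans (by linarith)) (by linarith)
  have h := hX.dist_smul_le_of_between g hq hq'
  refine ⟨q, ?_, hq.trans_le (min_le_left _ _)⟩
  change dist q (g • q) < _
  rcases le_total r (dist p (g • p) / 2) with h' | h'
  · rw [min_eq_left h'] at h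
    rcases h with h | h | h <;> linarith
  · rw [min_eq_right h'] at h
    rcases h with h | h | h <;> linarith

/-- The displacement of a point `p` almost between `x` and `y` is almost bounded by that of `x`
and `y`. -/
lemma IsHyperbolic.dist_smul_le_of_gromovProd_le (hX : IsHyperbolic δ X) (g : G) {x y p : X}
    {ρ ε : ℝ} (hx : dist x (g • x) ≤ ρ) (hy : dist y (g • y) ≤ ρ) (hp : gromovProd p x y ≤ ε) :
    dist p (g • p) ≤ ρ + 2 * ε + 2 * δ := by
  unfold gromovProd at hp
  have h1 := dist_triangle x (g • x) (g • p)
  have h2 := dist_triangle y (g • y) (g • p)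
  rw [dist_smul] at h1 h2
  have c1 := dist_comm x p
  have c2 := dist_comm (g • p) y
  have c3 := dist_comm p y
  rcases hX.four_point p x (g • p) y with h | h <;> linarith

/-- Axes are quasi-convex: a point almost between two points of the axis is close to the axis. -/
lemma IsHyperbolic.mem_cthickening_axis (hX : IsHyperbolic δ X) (hlen : IsLengthSpace X)
    (hδ : 0 < δ) {g : G} {x y p : X} (hx : x ∈ axis X δ g) (hy : y ∈ axis X δ g)
    (hp : gromovProd p x y ≤ 9 * δ) : p ∈ Metric.cthickening (13 * δ) (axis X δ g) := by
  have h := hX.dist_smul_le_of_gromovProd_le g (le_of_lt hx) (le_of_lt hy) hp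
  obtain ⟨q, hq, hpq⟩ := hX.exists_mem_axis hlen hδ g p (r := 13 * δ) (by linarith) (by linarith)
  exact Metric.mem_cthickening_of_dist_le p q _ _ hq hpq

lemma dist_smul_le_of_dist_axis_le {g : G} {x x' : X} {r : ℝ} (hx' : x' ∈ axis X δ g)
    (h : dist x x' ≤ r) : dist x (g • x) ≤ transLength X g + 8 * δ + 2 * r := by
  have h1 := dist_triangle4 x x' (g • x') (g • x)
  rw [dist_smul, dist_comm x' x] at h1
  have h2 : dist x' (g • x') < _ := hx'
  linarith

/-- Near the axis of `g`, the displacement of `gⁿ` is at most `n [g]`, up to an error which does not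
depend on `n`. -/
lemma IsHyperbolic.dist_pow_smul_le_of_dist_axis_le (hX : IsHyperbolic δ X)
    (hlen : IsLengthSpace X) (hδ : 0 < δ) {g : G} (hg : 10 * δ < transLength X g) {x x' : X}
    (hx' : x' ∈ axis X δ g) (h : dist x x' ≤ 14 * δ) (n : ℕ) :
    dist x (g ^ n • x) ≤ n * transLength X g + 46 * δ := by
  have : Nonempty X := ⟨x⟩
  have h1 := dist_triangle4 x x' (g ^ n • x') (g ^ n • x)
  rw [dist_smul, dist_comm x' x] at h1
  have h2 : dist x' (g • x') < _ := hx'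
  have h3 := hX.dist_pow_add_le hlen hδ g x' hg n n
  have h4 := hX.dist_sq_smul_le hδ (g ^ n) x'
  rw [← pow_mul, mul_two] at h4
  linarith [transLength_pow_le (X := X) g n]

end Isometries

/-! ### Sequences converging to infinity -/

section BoundaryAtInfinity

variable {X : Type u} [MetricSpace X] {δ : ℝ}

lemma tendsto_gromovProd_of_base {ι : Type*} {l : Filter ι} {y z : ι → X} (o : X)
    (h : Tendsto (fun i => gromovProd o (y i) (z i)) l atTop) (o' : X) :
    Tendsto (fun i => gromovProd o' (y i) (z i)) l atTop := by
  refine tendsto_atTop_mono (fun i => ?_) (tendsto_atTop_add_const_right l (-dist o o') h)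
  linarith [gromovProd_le_add_dist_base o o' (y i) (z i)]

/-- In a hyperbolic space, two sequences converging to infinity define the same point of the
boundary exactly when they are related. -/
lemma IsHyperbolic.mk_eq_mk_iff (hX : IsHyperbolic δ X) {y z : InfSeq X} :
    (Quot.mk InfSeq.Rel y : Boundary X) = Quot.mk InfSeq.Rel z ↔ y.Rel z := by
  rw [Quot.eq, Equivalence.eqvGen_iff]
  refine ⟨fun y o => ?_, fun {y z} h o => ?_, fun {a b c} hab hbc o => ?_⟩
  · exact (y.2 o).comp (tendsto_id.prodMk tendsto_id |>.mono_right prod_atTop_atTop_eq.le)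
  · simpa only [gromovProd_comm o] using h o
  · refine tendsto_atTop_mono (fun n => hX (a.1 n) (b.1 n) (c.1 n) o) ?_
    refine tendsto_atTop_add_const_right _ _ (tendsto_atTop.2 fun r => ?_)
    filter_upwards [tendsto_atTop.1 (hab o) r, tendsto_atTop.1 (hbc o) r] with n h1 h2
    exact le_min h1 h2

lemma InfSeq.tendsto_dist (y : InfSeq X) (o : X) :
    Tendsto (fun n => dist (y.1 n) o) atTop atTop := by
  have h := (y.2 o).comp (tendsto_id.prodMk tendsto_id |>.mono_right prod_atTop_atTop_eq.le)
  simpa only [Function.comp_def, id, gromovProd_self] using h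

/-- A sequence at bounded distance from a sequence converging to infinity converges to the same
point of the boundary. -/
lemma exists_infSeq_of_dist_le (y : InfSeq X) (z : ℕ → X) {R : ℝ} (h : ∀ n, dist (y.1 n) (z n) ≤ R) :
    ∃ z' : InfSeq X, z'.1 = z ∧ (Quot.mk InfSeq.Rel y : Boundary X) = Quot.mk InfSeq.Rel z' := by
  have key : ∀ o m n, gromovProd o (y.1 m) (y.1 n) - 2 * R ≤ gromovProd o (z m) (z n) := by
    intro o m n
    have h1 := gromovProd_le_add_dist_left o (y.1 m) (z m) (y.1 n)
    have h2 := gromovProd_le_add_dist_left o (y.1 n) (z n) (z m)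
    rw [gromovProd_comm o (y.1 n), gromovProd_comm o (z n)] at h2
    linarith [h m, h n]
  refine ⟨⟨z, fun o => ?_⟩, rfl, Quot.sound fun o => ?_⟩
  · exact tendsto_atTop_mono (fun p => key o p.1 p.2)
      (tendsto_atTop_add_const_right _ (-(2 * R)) (y.2 o))
  · have h0 := (y.2 o).comp (tendsto_id.prodMk tendsto_id |>.mono_right prod_atTop_atTop_eq.le)
    refine tendsto_atTop_mono (fun n => ?_) (tendsto_atTop_add_const_right _ (-R) h0)
    have h2 := gromovProd_le_add_dist_left o (y.1 n) (z n) (y.1 n)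
    rw [gromovProd_comm o (z n)] at h2
    simp only [Function.comp_def, id]
    linarith [h n]

end BoundaryAtInfinity

/-! ### Limit sets -/

section LimitSets

variable {G : Type v} [Group G] {X : Type u} [MetricSpace X] [MulAction G X] {δ : ℝ}

lemma mem_limitSet_iff {H : Subgroup G} {ξ : Boundary X} :
    ξ ∈ limitSet X H ↔ ∃ (x : X) (k : ℕ → G) (y : InfSeq X), (∀ n, k n ∈ H) ∧
      (∀ n, y.1 n = k n • x) ∧ Quot.mk InfSeq.Rel y = ξ := by
  simp only [limitSet, Set.mem_iUnion, boundaryOf, Set.mem_ofPred_eq]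
  constructor
  · rintro ⟨x, y, hy, rfl⟩
    choose k hk hk' using hy
    exact ⟨x, k, y, hk, hk', rfl⟩
  · rintro ⟨x, k, y, hk, hk', rfl⟩
    exact ⟨x, y, fun n => ⟨k n, hk n, hk' n⟩, rfl⟩

lemma limitSet_mono {H K : Subgroup G} (h : H ≤ K) : limitSet X H ⊆ limitSet X K := by
  intro ξ hξ
  obtain ⟨x, k, y, hk, hy, rfl⟩ := mem_limitSet_iff.1 hξ
  exact mem_limitSet_iff.2 ⟨x, k, y, fun n => h (hk n), hy, rfl⟩

lemma IsElementary.mono {H K : Subgroup G} (h : H ≤ K) (hK : IsElementary X K) :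
    IsElementary X H :=
  (Set.encard_le_encard (limitSet_mono h)).trans hK

lemma isElementary_of_isEmpty [IsEmpty X] (H : Subgroup G) : IsElementary X H := by
  have : limitSet X H = ∅ := by
    rw [Set.eq_empty_iff_forall_notMem]
    intro ξ hξ
    obtain ⟨x, -⟩ := mem_limitSet_iff.1 hξ
    exact isEmptyElim x
  simp [IsElementary, this]

lemma IsElliptic.mono {H K : Subgroup G} (h : H ≤ K) (hK : IsElliptic X K) : IsElliptic X H :=
  fun x => (hK x).subset (by rintro _ ⟨g, hg, rfl⟩; exact ⟨g, h hg, rfl⟩)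

lemma isElliptic_of_finite {H : Subgroup G} (h : (H : Set G).Finite) : IsElliptic X H :=
  fun x => ((h.image fun g => g • x).subset
    (by rintro _ ⟨g, hg, rfl⟩; exact ⟨g, hg, rfl⟩)).isBounded

variable [IsIsometricSMul G X]

/-- The limit set can be computed with any base point. -/
lemma exists_orbit_seq {H : Subgroup G} {ξ : Boundary X} (hξ : ξ ∈ limitSet X H) (o : X) :
    ∃ (k : ℕ → G) (y : InfSeq X), (∀ n, k n ∈ H) ∧ (∀ n, y.1 n = k n • o) ∧
      Quot.mk InfSeq.Rel y = ξ := by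
  obtain ⟨x, k, y, hk, hy, rfl⟩ := mem_limitSet_iff.1 hξ
  obtain ⟨z, hz, hyz⟩ := exists_infSeq_of_dist_le y (fun n => k n • o) (R := dist x o)
    (fun n => by rw [hy, dist_smul])
  exact ⟨k, z, hk, fun n => by rw [hz], hyz.symm⟩

lemma smul_mem_limitSet {H K : Subgroup G} {g : G} (h : ∀ k ∈ H, g * k * g⁻¹ ∈ K)
    {ξ : Boundary X} (hξ : ξ ∈ limitSet X H) : g • ξ ∈ limitSet X K := by
  obtain ⟨x, k, y, hk, hy, rfl⟩ := mem_limitSet_iff.1 hξ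
  refine mem_limitSet_iff.2 ⟨g • x, fun n => g * k n * g⁻¹, InfSeq.smul g y,
    fun n => h _ (hk n), fun n => ?_, rfl⟩
  change g • y.1 n = _
  rw [hy, mul_smul, inv_smul_smul, mul_smul]

lemma smul_limitSet_eq {H K : Subgroup G} {g : G} (h : ∀ k, k ∈ H ↔ g * k * g⁻¹ ∈ K) :
    g • limitSet X H = limitSet X K := by
  apply subset_antisymm
  · rintro _ ⟨ξ, hξ, rfl⟩
    exact smul_mem_limitSet (fun k hk => (h k).1 hk) hξ
  · intro ξ hξ
    rw [Set.mem_smul_set_iff_inv_smul_mem]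
    refine smul_mem_limitSet (fun k hk => (h _).2 ?_) hξ
    simpa [mul_assoc] using hk

lemma smul_limitSet_zpowers (g u : G) :
    g • limitSet X (Subgroup.zpowers u) = limitSet X (Subgroup.zpowers (g * u * g⁻¹)) := by
  apply smul_limitSet_eq
  intro k
  simp only [Subgroup.mem_zpowers_iff]
  exact exists_congr fun n => by simp

lemma smul_limitSet_of_mem {H : Subgroup G} {g : G} (hg : g ∈ H) :
    g • limitSet X H = limitSet X H :=
  smul_limitSet_eq fun k => by
    rw [H.mul_mem_cancel_right (H.inv_mem hg), H.mul_mem_cancel_left hg]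

/-- Passing to a subgroup with finitely many cosets does not change the limit set. -/
lemma limitSet_subset_of_finite {H K : Subgroup G} {S : Set G} (hS : S.Finite)
    (h : ∀ k ∈ K, ∃ g ∈ H, g⁻¹ * k ∈ S) : limitSet X K ⊆ limitSet X H := by
  intro ξ hξ
  obtain ⟨x, k, y, hk, hy, rfl⟩ := mem_limitSet_iff.1 hξ
  choose g hg hgS using fun n => h (k n) (hk n)
  obtain ⟨R, hR⟩ := (hS.image fun s => dist (s • x) x).bddAbove
  obtain ⟨z, hz, hyz⟩ := exists_infSeq_of_dist_le y (fun n => g n • x) (R := R) fun n => by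
    have : dist (((g n)⁻¹ * k n) • x) x ≤ R := hR ⟨_, hgS n, rfl⟩
    rwa [← dist_smul (g n), smul_smul, mul_inv_cancel_left, ← hy] at this
  exact mem_limitSet_iff.2 ⟨x, g, z, hg, fun n => by rw [hz], hyz.symm⟩

/-! ### The limit set of an isometry with large translation length -/

lemma IsHyperbolic.le_gromovProd_pow (hX : IsHyperbolic δ X) (hlen : IsLengthSpace X)
    (hδ : 0 < δ) {g : G} (hg : 10 * δ < transLength X g) (x : X) (m n : ℕ) :
    (min m n : ℕ) * (transLength X g - 6 * δ) - dist x (g • x) ≤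
      gromovProd x (g ^ m • x) (g ^ n • x) := by
  wlog hmn : m ≤ n generalizing m n
  · rw [gromovProd_comm, min_comm]
    exact this n m (le_of_not_ge hmn)
  obtain ⟨k, rfl⟩ := Nat.exists_eq_add_of_le hmn
  rw [min_eq_left hmn]
  unfold gromovProd
  rw [dist_pow_smul_pow_add_smul, dist_comm _ x, dist_comm _ x]
  linarith [hX.dist_pow_add_le hlen hδ g x hg m k, hX.le_dist_pow_smul hlen hδ g x hg m,
    transLength_le g x]

lemma IsHyperbolic.gromovProd_inv_pow_le (hX : IsHyperbolic δ X) (hlen : IsLengthSpace X)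
    (hδ : 0 < δ) {g : G} (hg : 10 * δ < transLength X g) (x : X) (m n : ℕ) :
    2 * gromovProd x (g⁻¹ ^ m • x) (g ^ n • x) ≤
      dist x (g • x) - transLength X g + 8 * δ := by
  unfold gromovProd
  have h1 : dist (g⁻¹ ^ m • x) x = dist x (g ^ m • x) := by
    rw [inv_pow, dist_comm, dist_inv_smul_eq]
  have h2 : dist (g⁻¹ ^ m • x) (g ^ n • x) = dist x (g ^ (m + n) • x) := by
    rw [← dist_smul (g ^ m), inv_pow, smul_inv_smul, smul_smul, pow_add]
  rw [h1, h2, dist_comm _ x]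
  linarith [hX.dist_pow_add_le hlen hδ g x hg m n]

lemma IsHyperbolic.convergesToInfinity_pow (hX : IsHyperbolic δ X) (hlen : IsLengthSpace X)
    (hδ : 0 < δ) {g : G} (hg : 10 * δ < transLength X g) (x : X) :
    ConvergesToInfinity fun n : ℕ => g ^ n • x := by
  refine tendsto_gromovProd_of_base x ?_
  refine tendsto_atTop_mono (fun p : ℕ × ℕ =>
    hX.le_gromovProd_pow hlen hδ hg x p.1 p.2) ?_
  refine tendsto_atTop_add_const_right _ (-_) (Tendsto.atTop_mul_const (by linarith)
    (tendsto_natCast_atTop_atTop.comp ?_))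
  refine tendsto_atTop.2 fun r => ?_
  filter_upwards [eventually_ge_atTop (r, r)] with p hp
  exact le_min hp.1 hp.2

/-- A sequence in the orbit of `x` under nonnegative powers of `g` converges, if it
converges to infinity, to the same point as `n ↦ gⁿ x`. -/
lemma IsHyperbolic.rel_pow (hX : IsHyperbolic δ X) (hlen : IsLengthSpace X)
    (hδ : 0 < δ) {g : G} (hg : 10 * δ < transLength X g) (x : X) (y z : InfSeq X)
    (hz : z.1 = fun n => g ^ n • x) (h : ∀ᶠ n in atTop, ∃ i : ℕ, y.1 n = g ^ i • x) :
    y.Rel z := by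
  obtain ⟨N, hN⟩ := eventually_atTop.1 h
  choose! i hi using hN
  refine tendsto_gromovProd_of_base x ?_
  have hpos : 0 < transLength X g := by linarith
  have hx : 0 < dist x (g • x) := hpos.trans_le (transLength_le g x)
  have hi' : Tendsto i atTop atTop := by
    refine tendsto_natCast_atTop_iff.1 ((tendsto_mul_const_atTop_of_pos hx).1
      (tendsto_atTop_mono' _ ?_ (y.tendsto_dist x)))
    filter_upwards [eventually_ge_atTop N] with n hn
    rw [hi n hn, dist_comm]
    exact dist_pow_smul_le g x _
  have hmin : Tendsto (fun n => min (i n) n) atTop atTop :=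
    tendsto_atTop.2 fun r => by
      filter_upwards [tendsto_atTop.1 hi' r, eventually_ge_atTop r] with n h1 h2
      exact le_min h1 h2
  refine tendsto_atTop_mono' _ ?_ (tendsto_atTop_add_const_right _ (-dist x (g • x))
    (Tendsto.atTop_mul_const (r := transLength X g - 6 * δ) (by linarith)
    (tendsto_natCast_atTop_atTop.comp hmin)))
  filter_upwards [eventually_ge_atTop N] with n hn
  rw [hi n hn, hz]
  exact hX.le_gromovProd_pow hlen hδ hg x (i n) n

variable (G) in
/-- An isometry whose translation length is large (more than `10 δ`), together with a base point.
The sequences of its positive and negative powers define the two points of its limit set. The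
standing hypotheses on the space are bundled as well. -/
structure LongIsometry (δ : ℝ) (X : Type u) [MetricSpace X] [MulAction G X] [IsIsometricSMul G X]
    where
  /-- The isometry. -/
  g : G
  /-- The base point. -/
  x : X
  long : 10 * δ < transLength X g
  hyp : IsHyperbolic δ X
  len : IsLengthSpace X
  pos : 0 < δ

namespace LongIsometry

variable (u : LongIsometry G δ X)

/-- The inverse isometry. -/
def inv : LongIsometry G δ X :=
  { u with g := u.g⁻¹, long := by rw [transLength_inv]; exact u.long }

/-- The orbit of the base point under the positive powers. -/
def seq : InfSeq X :=
  ⟨fun n => u.g ^ n • u.x, u.hyp.convergesToInfinity_pow u.len u.pos u.long u.x⟩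

/-- The attracting fixed point. -/
def ends : Boundary X := Quot.mk InfSeq.Rel u.seq

lemma ends_mem : u.ends ∈ limitSet X (Subgroup.zpowers u.g) :=
  mem_limitSet_iff.2 ⟨u.x, fun n => u.g ^ n, u.seq, fun n => Subgroup.npow_mem_zpowers u.g n,
    fun _ => rfl, rfl⟩

lemma inv_ends_mem : u.inv.ends ∈ limitSet X (Subgroup.zpowers u.g) := by
  have := u.inv.ends_mem
  rwa [show u.inv.g = u.g⁻¹ from rfl, Subgroup.zpowers_inv] at this

lemma ends_ne : u.ends ≠ u.inv.ends := by
  intro h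
  have h1 := u.hyp.mk_eq_mk_iff.1 h.symm u.x
  obtain ⟨n, hn⟩ := (tendsto_atTop.1 h1
    (dist u.x (u.g • u.x) - transLength X u.g + 8 * δ + 1)).exists
  have h2 := u.hyp.gromovProd_inv_pow_le u.len u.pos u.long u.x n n
  have h3 : dist u.x (u.g • u.x) - transLength X u.g + 8 * δ + 1 ≤
    gromovProd u.x (u.g⁻¹ ^ n • u.x) (u.g ^ n • u.x) := hn
  linarith [transLength_le u.g u.x, u.pos]

lemma limitSet_eq : limitSet X (Subgroup.zpowers u.g) = {u.ends, u.inv.ends} := by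
  apply subset_antisymm
  · intro ξ hξ
    obtain ⟨k, y, hk, hy, rfl⟩ := exists_orbit_seq hξ u.x
    -- two points of the orbit with large Gromov product are on the same side of the base point
    obtain ⟨⟨N, M⟩, hN⟩ := eventually_atTop.1 (tendsto_atTop.1 (y.2 u.x)
      (dist u.x (u.g • u.x) - transLength X u.g + 8 * δ + 1))
    replace hN : ∀ m ≥ max N M, ∀ n ≥ max N M,
        ¬ ∃ a b : ℕ, y.1 m = u.g⁻¹ ^ a • u.x ∧ y.1 n = u.g ^ b • u.x := by
      rintro m hm n hn ⟨a, b, ha, hb⟩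
      have h1 := hN (m, n) ⟨(le_max_left _ _).trans hm, (le_max_right _ _).trans hn⟩
      simp only [ha, hb] at h1
      linarith [u.hyp.gromovProd_inv_pow_le u.len u.pos u.long u.x a b,
        transLength_le u.g u.x, u.pos]
    have hsign : ∀ n, (∃ a : ℕ, y.1 n = u.g⁻¹ ^ a • u.x) ∨ ∃ b : ℕ, y.1 n = u.g ^ b • u.x := by
      intro n
      obtain ⟨i, hi⟩ := Subgroup.mem_zpowers_iff.1 (hk n)
      obtain ⟨a, rfl | rfl⟩ := i.eq_nat_or_neg
      · right; exact ⟨a, by rw [hy, ← hi, zpow_natCast]⟩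
      · left; exact ⟨a, by rw [hy, ← hi, zpow_neg, zpow_natCast, inv_pow]⟩
    rcases hsign (max N M) with ⟨a, ha⟩ | ⟨b, hb⟩
    · right
      refine u.hyp.mk_eq_mk_iff.2 (u.hyp.rel_pow u.len u.pos u.inv.long u.x y _ rfl ?_)
      filter_upwards [eventually_ge_atTop (max N M)] with n hn
      exact (hsign n).resolve_right fun ⟨b, hb⟩ => hN _ le_rfl n hn ⟨a, b, ha, hb⟩
    · left
      refine u.hyp.mk_eq_mk_iff.2 (u.hyp.rel_pow u.len u.pos u.long u.x y _ rfl ?_)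
      filter_upwards [eventually_ge_atTop (max N M)] with n hn
      exact (hsign n).resolve_left fun ⟨a, ha⟩ => hN n hn _ le_rfl ⟨a, b, ha, hb⟩
  · rintro _ (rfl | rfl)
    exacts [u.ends_mem, u.inv_ends_mem]

lemma encard_limitSet : (limitSet X (Subgroup.zpowers u.g)).encard = 2 := by
  rw [u.limitSet_eq, Set.encard_pair u.ends_ne]

lemma isLoxodromic : IsLoxodromic X u.g := u.encard_limitSet

/-- An elementary subgroup has the same limit set as any isometry with large translation length
that it contains. -/
lemma limitSet_eq_of_mem {H : Subgroup G} (hH : IsElementary X H) (hu : u.g ∈ H) :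
    limitSet X H = limitSet X (Subgroup.zpowers u.g) := by
  refine (Set.Finite.eq_of_subset_of_encard_le ?_ (limitSet_mono ?_) ?_).symm
  · exact Set.finite_of_encard_le_coe (k := 2) u.encard_limitSet.le
  · rwa [Subgroup.zpowers_le]
  · rw [u.encard_limitSet]; exact hH

lemma le_maxLoxodromic {H : Subgroup G} (hH : IsElementary X H) (hu : u.g ∈ H) :
    H ≤ maxLoxodromic X u.g := by
  intro h hh
  rw [maxLoxodromic, MulAction.mem_stabilizer_iff, ← u.limitSet_eq_of_mem hH hu]
  exact smul_limitSet_of_mem hh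

end LongIsometry

end LimitSets

/-! ### Acylindricity: subgroups all of whose elements have small translation length -/

section Acylindrical

variable {G : Type v} [Group G] {X : Type u} [MetricSpace X] [MulAction G X] [IsIsometricSMul G X]
  {δ : ℝ}

/-- Finitely many elements of a subgroup all of whose elements have small translation length
almost fix a common point. At a point `x` which almost minimizes the largest displacement `r`, either
all the elements with displacement close to `r` move `x` in the same direction, and moving `x` in
this direction decreases `r`, or two of them move `x` in different directions, and then the
quotient of these two has a large translation length. -/
lemma IsHyperbolic.exists_forall_dist_le [Nonempty X] (hX : IsHyperbolic δ X)
    (hlen : IsLengthSpace X) (hδ : 0 < δ) {H : Subgroup G}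
    (hH : ∀ h ∈ H, transLength X h ≤ 10 * δ) (F : Finset G) (hF : ∀ f ∈ F, f ∈ H) :
    ∃ x : X, ∀ f ∈ F, dist x (f • x) ≤ 100 * δ := by
  rcases F.eq_empty_or_nonempty with rfl | hne
  · exact ⟨Classical.arbitrary X, by simp⟩
  by_contra! hcon
  set ρ : X → ℝ := fun x => F.sup' hne fun f => dist x (f • x) with hρ
  have hle : ∀ x, ∀ f ∈ F, dist x (f • x) ≤ ρ x := fun x f hf =>
    Finset.le_sup' (fun f => dist x (f • x)) hf
  have hρ0 : ∀ x, 100 * δ ≤ ρ x := fun x => by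
    obtain ⟨f, hf, h⟩ := hcon x
    exact h.le.trans (hle x f hf)
  set r := ⨅ x, ρ x with hr
  have hrle : ∀ x, r ≤ ρ x := fun x => ciInf_le ⟨100 * δ, by rintro _ ⟨y, rfl⟩; exact hρ0 y⟩ x
  have hr0 : 100 * δ ≤ r := le_ciInf hρ0
  obtain ⟨x, hx⟩ : ∃ x, ρ x < r + δ := exists_lt_of_ciInf_lt (by linarith)
  by_cases hdir : ∀ f ∈ F, ∀ f' ∈ F, r - 14 * δ < dist x (f • x) →
      r - 14 * δ < dist x (f' • x) → 6 * δ ≤ gromovProd x (f • x) (f' • x)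
  · obtain ⟨f₀, hf₀, hmax⟩ := Finset.exists_mem_eq_sup' hne fun f => dist x (f • x)
    replace hmax : r ≤ dist x (f₀ • x) := (hrle x).trans hmax.le
    obtain ⟨y, hy, hy'⟩ := hlen.exists_between x (f₀ • x) (t := 6 * δ) (η := δ)
      (by linarith) (by linarith) hδ
    refine (hrle y).not_gt ((Finset.sup'_lt_iff hne).2 fun f hf => ?_)
    have hfx := hle x f hf
    rcases le_or_gt (dist x (f • x)) (r - 14 * δ) with hsmall | hbig
    · have := dist_triangle4 y x (f • x) (f • y)
      rw [dist_smul, dist_comm y x, hy] at this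
      linarith
    · have h1 := hX y (f₀ • x) (f • x) x
      have h2 := hdir f₀ hf₀ f hf (by linarith) hbig
      have h3 : 6 * δ - δ / 2 ≤ gromovProd x y (f₀ • x) := by
        unfold gromovProd
        rw [dist_comm y x, dist_comm (f₀ • x) x]
        linarith
      have h4 : 6 * δ - δ / 2 ≤ min (gromovProd x y (f₀ • x)) (gromovProd x (f₀ • x) (f • x)) :=
        le_min h3 (by linarith)
      have h5 : dist y (f • x) ≤ dist x (f • x) - 6 * δ + 3 * δ := by
        have h6 : 6 * δ - δ / 2 - δ ≤ gromovProd x y (f • x) := by linarith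
        unfold gromovProd at h6
        rw [dist_comm y x, dist_comm (f • x) x] at h6
        linarith
      have hT := hX.dist_sq_smul_le hδ f x
      have hHf := hH f (hF f hf)
      rcases hX.dist_smul_le_of_between f hy h5 with h | h | h <;> linarith
  · push Not at hdir
    obtain ⟨f, hf, f', hf', hbig, hbig', hlt⟩ := hdir
    have key : ∀ f ∈ F, r - 14 * δ < dist x (f • x) → 20 * δ < gromovProd x (f • x) (f⁻¹ • x) := by
      intro f hf hbig
      have hT := hX.dist_sq_smul_le hδ f x
      have hHf := hH f (hF f hf)
      unfold gromovProd
      rw [dist_comm _ x, dist_comm _ x, dist_inv_smul_eq, ← dist_smul f (f • x), smul_inv_smul,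
        smul_smul, ← pow_two, dist_comm _ x]
      linarith
    have h1 : gromovProd x (f⁻¹ • x) (f'⁻¹ • x) ≤ 8 * δ := by
      have := hX.gromovProd_le_of_lt hδ hlt.le (x' := f⁻¹ • x) (y' := f'⁻¹ • x)
        (by linarith [key f hf hbig]) (by linarith [key f' hf' hbig'])
      linarith
    have hd : dist x ((f⁻¹ * f') • x) = dist (f • x) (f' • x) := by
      rw [mul_smul, ← dist_smul f, smul_inv_smul]
    have hd' : dist x ((f⁻¹ * f')⁻¹ • x) = dist (f • x) (f' • x) := by
      rw [dist_inv_smul_eq, hd]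
    unfold gromovProd at hlt
    rw [dist_comm _ x, dist_comm _ x] at hlt
    have h2 : 20 * δ < gromovProd x (f⁻¹ • x) ((f⁻¹ * f') • x) := by
      unfold gromovProd
      rw [dist_comm _ x, dist_comm _ x, hd, dist_inv_smul_eq, mul_smul, dist_smul]
      linarith
    have h3 : 20 * δ < gromovProd x (f'⁻¹ • x) ((f⁻¹ * f')⁻¹ • x) := by
      unfold gromovProd
      rw [dist_comm _ x, dist_comm _ x, hd', dist_inv_smul_eq, mul_inv_rev, inv_inv, mul_smul,
        dist_smul]
      linarith
    have h4 := hX.gromovProd_le_of_lt hδ h1 (x' := (f⁻¹ * f') • x) (y' := (f⁻¹ * f')⁻¹ • x)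
      (by linarith) (by linarith)
    have hg := hH _ (H.mul_mem (H.inv_mem (hF f hf)) (hF f' hf'))
    have hT := hX.dist_sq_smul_le hδ (f⁻¹ * f') x
    unfold gromovProd at h4
    rw [dist_comm _ x, dist_comm _ x, hd, hd', ← dist_smul (f⁻¹ * f') _ ((f⁻¹ * f')⁻¹ • x),
      smul_inv_smul, smul_smul, ← pow_two, dist_comm _ x] at h4
    linarith

/-- In an acylindrical action, a subgroup with unbounded orbits contains an element with large
translation length. -/
lemma IsAcylindrical.exists_long (hacyl : IsAcylindrical G X) (hX : IsHyperbolic δ X)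
    (hlen : IsLengthSpace X) (hδ : 0 < δ) {H : Subgroup G} (hH : ¬ IsElliptic X H) :
    ∃ u : LongIsometry G δ X, u.g ∈ H := by
  by_contra! hcon
  refine hH fun x => ?_
  have : Nonempty X := ⟨x⟩
  replace hcon : ∀ h ∈ H, transLength X h ≤ 10 * δ := fun h hh => by
    by_contra! hlt
    exact hcon ⟨h, x, hlt, hX, hlen, hδ⟩ hh
  rcases (H : Set G).finite_or_infinite with hfin | hinf
  · exact isElliptic_of_finite hfin x
  classical
  obtain ⟨M, L, -, hL, hML⟩ := hacyl (100 * δ) (by linarith)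
  obtain ⟨F, hFH, hFcard⟩ := hinf.exists_subset_card_eq (M + 1)
  obtain ⟨x₀, hx₀⟩ := hX.exists_forall_dist_le hlen hδ hcon F hFH
  refine (Metric.isBounded_closedBall (x := x) (r := 2 * dist x x₀ + 2 * L + 100 * δ)).subset ?_
  rintro _ ⟨h, hh, rfl⟩
  obtain ⟨y, hy⟩ := hX.exists_forall_dist_le hlen hδ hcon (insert h F) (by
    intro f hf
    rcases Finset.mem_insert.1 hf with rfl | hf
    exacts [hh, hFH hf])
  have hlt : dist x₀ y < L := by
    by_contra! hle
    have h1 : (F : Set G).encard ≤ M := (Set.encard_le_encard fun f hf =>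
      show dist x₀ (f • x₀) ≤ _ ∧ dist y (f • y) ≤ _ from
        ⟨hx₀ f hf, hy f (Finset.mem_insert_of_mem hf)⟩).trans (hML x₀ y hle)
    rw [Set.encard_coe_eq_coe_finsetCard, hFcard] at h1
    exact absurd (Nat.cast_le.1 h1) (by omega)
  have h1 := hy h (Finset.mem_insert_self h F)
  have h2 := dist_triangle4 x y (h • y) (h • x)
  have h3 := dist_triangle x x₀ y
  rw [dist_smul, dist_comm y x] at h2
  rw [Metric.mem_closedBall, dist_comm]
  linarith

end Acylindrical

/-! ### Groups with a central cyclic subgroup of finite index -/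

open scoped IsMulCommutative in
/-- In a group with a central infinite cyclic subgroup of finite index, the elements of finite
order form a finite subgroup, and every other element has a power which is a nontrivial power of the
central element. The transfer to the central subgroup is a power map, so its kernel consists of the
elements of finite order. -/
lemma exists_torsion_subgroup {P : Type*} [Group P] {z : P} (hz : ∀ p, Commute p z)
    (hinf : ¬ IsOfFinOrder z) {S : Set P} (hS : S.Finite) (hcos : ∀ p, ∃ j : ℤ, z ^ j * p ∈ S) :
    (∃ T : Subgroup P, Finite T ∧ ∀ p, p ∈ T ↔ IsOfFinOrder p) ∧
      ∀ p, ¬ IsOfFinOrder p → ∃ k : ℕ, ∃ i : ℤ, k ≠ 0 ∧ i ≠ 0 ∧ p ^ k = z ^ i := by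
  set Z := Subgroup.zpowers z with hZ
  have hcen : Z ≤ Subgroup.center P := by
    rw [hZ, Subgroup.zpowers_le, Subgroup.mem_center_iff]
    exact fun p => hz p
  have hzpow : ∀ p ∈ Z, IsOfFinOrder p → p = 1 := by
    rintro p hp hfin
    obtain ⟨i, rfl⟩ := Subgroup.mem_zpowers_iff.1 hp
    obtain ⟨n, rfl | rfl⟩ := i.eq_nat_or_neg
    · rw [zpow_natCast, isOfFinOrder_pow] at hfin
      simp [hfin.resolve_left hinf]
    · rw [zpow_neg, isOfFinOrder_inv_iff, zpow_natCast, isOfFinOrder_pow] at hfin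
      simp [hfin.resolve_left hinf]
  have hfinite : Finite (P ⧸ Z) := by
    have := hS.to_subtype
    refine Finite.of_surjective (fun s : S => (QuotientGroup.mk s.1 : P ⧸ Z)) fun q => ?_
    induction q using QuotientGroup.induction_on with
    | H p =>
      obtain ⟨j, hj⟩ := hcos p
      refine ⟨⟨_, hj⟩, QuotientGroup.eq.2 ?_⟩
      change (z ^ j * p)⁻¹ * p ∈ Z
      rw [← ((hz p).zpow_right j).eq, mul_inv_rev, inv_mul_cancel_right]
      exact Z.inv_mem (Subgroup.zpow_mem_zpowers z j)
  have : Z.FiniteIndex := Subgroup.finiteIndex_of_finite_quotient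
  set φ : P →* Subgroup.center P := 
    MonoidHom.transfer (H := Z) (A := Subgroup.center P) (Subgroup.inclusion hcen) with hφ
  have hpow : ∀ p : P, p ^ Z.index ∈ Z ∧ (φ p = 1 ↔
      p ^ Z.index = 1) := by
    intro p
    have key : ∀ (k : ℕ) (g₀ : P), g₀⁻¹ * p ^ k * g₀ ∈ Z → g₀⁻¹ * p ^ k * g₀ = p ^ k := by
      intro k g₀ h
      have := Subgroup.mem_center_iff.1 (hcen h) g₀
      exact mul_right_cancel (b := g₀) (by rw [← this]; simp [mul_assoc])
    refine ⟨MonoidHom.transfer_eq_pow_aux p key, ?_⟩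
    rw [hφ, MonoidHom.transfer_eq_pow _ p key]
    simp [Subtype.ext_iff]
  have hker : ∀ p, p ∈ φ.ker ↔ IsOfFinOrder p := by
    intro p
    rw [MonoidHom.mem_ker, (hpow p).2]
    constructor
    · intro h
      exact isOfFinOrder_iff_pow_eq_one.2
        ⟨Z.index, Nat.pos_of_ne_zero Subgroup.FiniteIndex.index_ne_zero, h⟩
    · exact fun h => hzpow _ (hpow p).1 h.pow
  refine ⟨⟨_, ?_, hker⟩, fun p hp => ?_⟩
  · refine Finite.of_injective
      (fun t : φ.ker => (QuotientGroup.mk t.1 : P ⧸ Z)) ?_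
    intro t t' h
    have h1 := hzpow _ (QuotientGroup.eq.1 h)
      ((hker _).1 (mul_mem (inv_mem t.2) t'.2))
    exact Subtype.ext (inv_mul_eq_one.1 h1)
  · obtain ⟨i, hi⟩ := Subgroup.mem_zpowers_iff.1 (hpow p).1
    refine ⟨Z.index, i, Subgroup.FiniteIndex.index_ne_zero, ?_, hi.symm⟩
    rintro rfl
    exact hp (isOfFinOrder_iff_pow_eq_one.2
      ⟨Z.index, Nat.pos_of_ne_zero Subgroup.FiniteIndex.index_ne_zero, by simpa using hi.symm⟩)

/-! ### The maximal loxodromic subgroup of an isometry with large translation length -/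

section MaximalLoxodromic

variable {G : Type v} [Group G] {X : Type u} [MetricSpace X] [MulAction G X] [IsIsometricSMul G X]
  {δ : ℝ}

namespace LongIsometry

variable (u : LongIsometry G δ X)

/-- The error with which the orbit of the base point is geodesic. -/
noncomputable def err : ℝ := (dist u.x (u.g • u.x) - transLength X u.g + 8 * δ) / 2

lemma err_nonneg : 0 ≤ u.err := by
  unfold err
  linarith [transLength_le u.g u.x, u.pos]

lemma gromovProd_pow_le (i : ℤ) (k l : ℕ) :
    gromovProd (u.g ^ (i + k) • u.x) (u.g ^ i • u.x) (u.g ^ (i + k + l) • u.x) ≤ u.err := by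
  unfold gromovProd err
  have h1 : dist (u.g ^ i • u.x) (u.g ^ (i + k) • u.x) = dist u.x (u.g ^ k • u.x) := by
    rw [zpow_add, mul_smul, dist_smul, zpow_natCast]
  have h2 : dist (u.g ^ (i + k) • u.x) (u.g ^ (i + k + l) • u.x) = dist u.x (u.g ^ l • u.x) := by
    rw [zpow_add _ (i + k), mul_smul, dist_smul, zpow_natCast]
  have h3 : dist (u.g ^ i • u.x) (u.g ^ (i + k + l) • u.x) = dist u.x (u.g ^ (k + l) • u.x) := by
    rw [add_assoc, zpow_add, mul_smul, dist_smul, ← Nat.cast_add, zpow_natCast]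
  rw [dist_comm (u.g ^ (i + k + l) • u.x), h1, h2, h3]
  linarith [u.hyp.dist_pow_add_le u.len u.pos u.g u.x u.long k l]

/-- The orbit of the base point is quasi-convex. -/
lemma exists_pow_dist_le (i : ℤ) (N : ℕ) {p : X} {c : ℝ}
    (h : gromovProd p (u.g ^ i • u.x) (u.g ^ (i + N) • u.x) ≤ c) :
    ∃ j : ℤ, dist p (u.g ^ j • u.x) ≤ 2 * (c + δ) + dist u.x (u.g • u.x) + u.err := by
  have hc : 0 ≤ c := (gromovProd_nonneg _ _ _).trans h
  have hδ := u.pos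
  have he := u.err_nonneg
  have hD := dist_nonneg (x := u.x) (y := u.g • u.x)
  by_cases hend : dist (u.g ^ (i + N) • u.x) p ≤ c + δ
  · exact ⟨i + N, by rw [dist_comm]; linarith⟩
  -- the first point of the orbit which is not on the same side of `p` as the initial point
  have hex : ∃ n : ℕ, c + δ < gromovProd p (u.g ^ (i + n) • u.x) (u.g ^ (i + N) • u.x) :=
    ⟨N, by rw [gromovProd_self]; linarith⟩
  classical
  obtain ⟨n, hn⟩ : ∃ n, Nat.find hex = n + 1 := by
    refine Nat.exists_eq_succ_of_ne_zero fun h0 => ?_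
    have := Nat.find_spec hex
    rw [h0] at this
    simp only [Nat.cast_zero, add_zero] at this
    linarith
  have h1 : c + δ < gromovProd p (u.g ^ (i + (n + 1 : ℕ)) • u.x) (u.g ^ (i + N) • u.x) := by
    rw [← hn]; exact Nat.find_spec hex
  have h2 : gromovProd p (u.g ^ (i + n) • u.x) (u.g ^ (i + N) • u.x) ≤ c + δ :=
    not_lt.1 (Nat.find_min hex (by omega))
  have hnN : n + 1 ≤ N := hn ▸ Nat.find_min' hex (by rw [gromovProd_self]; linarith)
  have h3 : gromovProd p (u.g ^ i • u.x) (u.g ^ (i + (n + 1 : ℕ)) • u.x) ≤ c + δ :=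
    (u.hyp.le_or_le_of_gromovProd_le h).resolve_right (by linarith)
  have h4 : dist (u.g ^ (i + n) • u.x) (u.g ^ (i + (n + 1 : ℕ)) • u.x) =
      dist u.x (u.g • u.x) := by
    rw [Nat.cast_add, ← add_assoc, zpow_add _ (i + n), mul_smul, dist_smul, Nat.cast_one, zpow_one]
  have h5 := gromovProd_le_add_dist_left p (u.g ^ (i + n) • u.x)
    (u.g ^ (i + (n + 1 : ℕ)) • u.x) (u.g ^ i • u.x)
  rw [h4, gromovProd_comm p _ (u.g ^ i • u.x), gromovProd_comm p _ (u.g ^ i • u.x)] at h5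
  obtain ⟨l, rfl⟩ := Nat.exists_eq_add_of_le (show n ≤ N by omega)
  have h6 := u.gromovProd_pow_le i n l
  have h7 := gromovProd_nonneg p (u.g ^ i • u.x) (u.g ^ (i + (n + l : ℕ)) • u.x)
  refine ⟨i + n, ?_⟩
  rw [Nat.cast_add, ← add_assoc] at h2 h7
  unfold gromovProd at *
  have c1 := dist_comm p (u.g ^ (i + n) • u.x)
  have c2 := dist_comm (u.g ^ (i + n + l) • u.x) (u.g ^ (i + n) • u.x)
  linarith

/-- The pointwise stabilizer of the limit set. -/
def pointStab : Subgroup G :=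
  MulAction.stabilizer G u.ends ⊓ MulAction.stabilizer G u.inv.ends

lemma tendsto_of_smul_ends {f : G} (hf : f • u.ends = u.ends) (o : X) :
    Tendsto (fun n : ℕ => gromovProd o (f • u.g ^ n • u.x) (u.g ^ n • u.x)) atTop atTop :=
  u.hyp.mk_eq_mk_iff.1 (show Quot.mk InfSeq.Rel (InfSeq.smul f u.seq) = Quot.mk _ u.seq from hf) o

/-- An isometry fixing both ends maps the base point close to its orbit. -/
lemma exists_pow_dist_smul_le {f : G} (hf : f ∈ u.pointStab) :
    ∃ j : ℤ, dist (f • u.x) (u.g ^ j • u.x) ≤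
      3 * u.err + 6 * δ + dist u.x (u.g • u.x) := by
  obtain ⟨n, h1, h2⟩ := ((tendsto_atTop.1 (u.tendsto_of_smul_ends hf.1 (f • u.x))
    (u.err + 2 * δ + 1)).and (tendsto_atTop.1 (u.inv.tendsto_of_smul_ends hf.2 (f • u.x))
    (u.err + 2 * δ + 1))).exists
  have h3 : gromovProd (f • u.x) (f • u.inv.g ^ n • u.x) (f • u.g ^ n • u.x) ≤ u.err := by
    have := u.hyp.gromovProd_inv_pow_le u.len u.pos u.long u.x n n
    rw [gromovProd_smul, inv_smul_smul]
    change gromovProd u.x (u.g⁻¹ ^ n • u.x) _ ≤ _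
    unfold err
    linarith
  have h4 := u.hyp.gromovProd_le_of_lt u.pos h3 (lt_of_lt_of_le (by linarith) h2)
    (lt_of_lt_of_le (by linarith) h1)
  obtain ⟨j, hj⟩ := u.exists_pow_dist_le (-n) (2 * n) (p := f • u.x) (c := u.err + 2 * δ) (by
    convert h4 using 2
    · rw [zpow_neg, zpow_natCast, ← inv_pow]; rfl
    · congr 1
      rw [← zpow_natCast]
      congr 1
      push_cast
      ring)
  exact ⟨j, by linarith⟩

/-- An isometry fixing both ends almost acts on the orbit of the base point as a power. -/
lemma exists_shift : ∃ C : ℝ, 0 ≤ C ∧ ∀ f ∈ u.pointStab, ∃ j : ℤ, ∀ k : ℕ,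
    dist (f • u.g ^ k • u.x) (u.g ^ j • u.g ^ k • u.x) ≤ C := by
  set C₁ := 3 * u.err + 6 * δ + dist u.x (u.g • u.x) with hC₁
  have hδ := u.pos
  have he := u.err_nonneg
  have hC₁0 : 0 ≤ C₁ := by
    have := dist_nonneg (x := u.x) (y := u.g • u.x)
    linarith
  refine ⟨C₁ + 2 * (u.err + δ + C₁) + 2 * δ, by linarith, fun f hf => ?_⟩
  obtain ⟨j, hj⟩ := u.exists_pow_dist_smul_le hf
  refine ⟨j, fun k => ?_⟩
  set p := f • u.g ^ k • u.x with hp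
  set q := u.g ^ j • u.g ^ k • u.x with hq
  obtain ⟨n, hn, hnk, hnj⟩ := ((tendsto_atTop.1 (u.tendsto_of_smul_ends hf.1 p)
    (u.err + δ + 1)).and ((eventually_ge_atTop k).and (eventually_ge_atTop (j + k).toNat))).exists
  set b := u.g ^ n • u.x with hb
  -- both `p` and `q` are almost between `g ^ j x` and `g ^ n x`
  have h1 : gromovProd p (f • u.x) (f • b) ≤ u.err := by
    obtain ⟨l, rfl⟩ := Nat.exists_eq_add_of_le hnk
    have := u.gromovProd_pow_le 0 k l
    rw [gromovProd_smul, hp, inv_smul_smul, hb]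
    simpa only [zero_add, zpow_zero, one_smul, ← Nat.cast_add, zpow_natCast] using this
  have h2 : gromovProd p (f • u.x) b ≤ u.err + δ :=
    (u.hyp.le_or_le_of_gromovProd_le h1 (y := b)).resolve_right (by
      rw [gromovProd_comm]; linarith)
  have h3 : gromovProd p (u.g ^ j • u.x) b ≤ u.err + δ + C₁ := by
    have := gromovProd_le_add_dist_left p (u.g ^ j • u.x) (f • u.x) b
    rw [dist_comm] at this
    linarith
  have h4 : gromovProd q (u.g ^ j • u.x) b ≤ u.err := by
    have := u.gromovProd_pow_le j k (n - (j + k)).toNat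
    rw [Int.toNat_of_nonneg (by omega), show j + k + (n - (j + k)) = n by ring, zpow_natCast,
      zpow_add, mul_smul, zpow_natCast] at this
    exact this
  have e1 : dist (f • u.x) p = dist (u.g ^ j • u.x) q := by rw [hp, hq, dist_smul, dist_smul]
  have h5 := dist_triangle (f • u.x) (u.g ^ j • u.x) p
  have h6 := dist_triangle (u.g ^ j • u.x) (f • u.x) p
  unfold gromovProd at h3 h4
  have c1 := dist_comm (f • u.x) (u.g ^ j • u.x)
  have c2 := dist_comm p (u.g ^ j • u.x)
  have c3 := dist_comm b p
  have c4 := dist_comm b q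
  rcases u.hyp.four_point p (u.g ^ j • u.x) q b with h | h <;> linarith

lemma not_isOfFinOrder : ¬ IsOfFinOrder u.g := by
  intro h
  obtain ⟨n, hn, h1⟩ := isOfFinOrder_iff_pow_eq_one.1 h
  have h2 := u.hyp.le_dist_pow_smul u.len u.pos u.g u.x u.long n
  rw [h1, one_smul, dist_self] at h2
  have h3 : (0 : ℝ) < n := by exact_mod_cast hn
  nlinarith [u.long, u.pos]

/-- By acylindricity, some power of `u` commutes with all the isometries fixing both ends, and the
powers of `u` have finite index among these isometries. -/
lemma exists_commute_pow (hacyl : IsAcylindrical G X) :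
    ∃ N : ℕ, 0 < N ∧ ∃ S : Set G, S.Finite ∧
      ∀ f ∈ u.pointStab, Commute f (u.g ^ N) ∧ ∃ j : ℤ, u.g ^ j * f ∈ S := by
  obtain ⟨C, hC, hshift⟩ := u.exists_shift
  obtain ⟨M, L, -, -, hML⟩ := hacyl C hC
  obtain ⟨q, hq⟩ : ∃ q : ℕ, L ≤ dist u.x (u.g ^ q • u.x) := by
    have hpos : 0 < transLength X u.g - 6 * δ := by linarith [u.long, u.pos]
    obtain ⟨q, hq⟩ := exists_nat_ge (L / (transLength X u.g - 6 * δ))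
    rw [div_le_iff₀ hpos] at hq
    exact ⟨q, hq.trans (u.hyp.le_dist_pow_smul u.len u.pos u.g u.x u.long q)⟩
  set S := {g : G | dist u.x (g • u.x) ≤ C ∧ dist (u.g ^ q • u.x) (g • u.g ^ q • u.x) ≤ C} with hS
  have hcard : S.encard ≤ M := hML _ _ hq
  have hmem : ∀ f ∈ u.pointStab, ∃ j : ℤ, ∀ k : ℕ, (u.g ^ k)⁻¹ * (u.g ^ (-j) * f) * u.g ^ k ∈ S := by
    intro f hf
    obtain ⟨j, hj⟩ := hshift f hf
    have key : ∀ k i : ℕ, dist (u.g ^ i • u.x)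
        (((u.g ^ k)⁻¹ * (u.g ^ (-j) * f) * u.g ^ k) • u.g ^ i • u.x) ≤ C := by
      intro k i
      rw [← dist_smul (u.g ^ j * u.g ^ k), dist_comm]
      convert hj (k + i) using 2
      · simp [smul_smul, pow_add, mul_assoc]
      · simp only [smul_smul, pow_add, mul_assoc]
    exact ⟨j, fun k => ⟨by simpa using key k 0, key k q⟩⟩
  refine ⟨M.factorial, M.factorial_pos, S, Set.finite_of_encard_le_coe hcard, fun f hf => ?_⟩
  obtain ⟨j, hj⟩ := hmem f hf
  refine ⟨?_, -j, by simpa using hj 0⟩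
  obtain ⟨a, b, hab, heq⟩ : ∃ a b : Fin (M + 1), a < b ∧
      (u.g ^ (a : ℕ))⁻¹ * (u.g ^ (-j) * f) * u.g ^ (a : ℕ) =
        (u.g ^ (b : ℕ))⁻¹ * (u.g ^ (-j) * f) * u.g ^ (b : ℕ) := by
    by_contra! hcon
    have hinj : Function.Injective fun a : Fin (M + 1) =>
        (u.g ^ (a : ℕ))⁻¹ * (u.g ^ (-j) * f) * u.g ^ (a : ℕ) := by
      intro a b h
      rcases lt_trichotomy a b with h' | h' | h'
      · exact absurd h (hcon a b h')
      · exact h'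
      · exact absurd h.symm (hcon b a h')
    have h1 := hinj.encard_range.trans
      (Set.encard_le_encard (Set.range_subset_iff.2 fun a : Fin (M + 1) => hj a))
    simp only [ENat.card_eq_coe_fintype_card, Fintype.card_fin] at h1
    exact absurd (Nat.cast_le.1 (h1.trans hcard)) (by omega)
  have hlt : (a : ℕ) < b := hab
  have hcomm : Commute f (u.g ^ ((b : ℕ) - a)) := by
    have hb : u.g ^ (b : ℕ) = u.g ^ (a : ℕ) * u.g ^ ((b : ℕ) - a) := by
      rw [← pow_add, Nat.add_sub_cancel' hlt.le]
    set v := u.g ^ ((b : ℕ) - a) with hv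
    have hva : Commute (u.g ^ (a : ℕ)) v := ((Commute.refl u.g).pow_pow _ _)
    have hvj : Commute (u.g ^ (-j)) v := ((Commute.refl u.g).pow_right _).zpow_left _
    have h1 : Commute (u.g ^ (-j) * f) v := by
      rw [hb, hva.eq] at heq
      have h2 : u.g ^ (-j) * f = v⁻¹ * (u.g ^ (-j) * f) * v := by
        have := congrArg (fun w => u.g ^ (a : ℕ) * w * (u.g ^ (a : ℕ))⁻¹) heq
        simpa [mul_assoc] using this
      have h3 : v * (u.g ^ (-j) * f) = u.g ^ (-j) * f * v := by
        conv_lhs => rw [h2]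
        simp [mul_assoc]
      exact h3.symm
    have h4 : f = (u.g ^ (-j))⁻¹ * (u.g ^ (-j) * f) := by simp
    rw [h4]
    exact hvj.inv_left.mul_left h1
  obtain ⟨d, hd⟩ : (b : ℕ) - a ∣ M.factorial :=
    Nat.dvd_factorial (by omega) (by omega)
  rw [hd, pow_mul]
  exact hcomm.pow_right d

end LongIsometry

end MaximalLoxodromic

section MaximalLoxodromic

variable {G : Type v} [Group G] {X : Type u} [MetricSpace X] [MulAction G X] [IsIsometricSMul G X]
  {δ : ℝ}

lemma limitSet_zpowers_zpow (g : G) {i : ℤ} (hi : i ≠ 0) :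
    limitSet X (Subgroup.zpowers (g ^ i)) = limitSet X (Subgroup.zpowers g) := by
  apply subset_antisymm
  · exact limitSet_mono (Subgroup.zpowers_le.2 (Subgroup.zpow_mem_zpowers g i))
  · refine limitSet_subset_of_finite ((Set.finite_Ico 0 |i|).image fun r : ℤ => g ^ r) ?_
    intro k hk
    obtain ⟨m, rfl⟩ := Subgroup.mem_zpowers_iff.1 hk
    refine ⟨(g ^ i) ^ (m / i), Subgroup.zpow_mem_zpowers _ _, m % i,
      ⟨Int.emod_nonneg m hi, Int.emod_lt_abs m hi⟩, ?_⟩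
    change g ^ (m % i) = _
    rw [← zpow_mul, ← zpow_neg, ← zpow_add, Int.emod_def]
    congr 1
    ring

namespace LongIsometry

variable (u : LongIsometry G δ X)

lemma smul_ends : u.g • u.ends = u.ends :=
  u.hyp.mk_eq_mk_iff.2 (u.hyp.rel_pow u.len u.pos u.long u.x (InfSeq.smul u.g u.seq) _ rfl
    (Eventually.of_forall fun n => ⟨n + 1, by rw [pow_succ', mul_smul]; rfl⟩))

lemma mem_pointStab : u.g ∈ u.pointStab := by
  refine ⟨u.smul_ends, ?_⟩
  have h := u.inv.smul_ends
  change u.g⁻¹ • u.inv.ends = u.inv.ends at h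
  change u.g • u.inv.ends = u.inv.ends
  rwa [inv_smul_eq_iff, eq_comm] at h

lemma pointStab_le : u.pointStab ≤ maxLoxodromic X u.g := by
  rintro f ⟨h1, h2⟩
  rw [maxLoxodromic, MulAction.mem_stabilizer_iff, u.limitSet_eq, ← Set.image_smul,
    Set.image_pair]
  rw [MulAction.mem_stabilizer_iff.1 h1, MulAction.mem_stabilizer_iff.1 h2]

lemma mem_pointStab_or {e : G} (he : e ∈ maxLoxodromic X u.g) :
    e ∈ u.pointStab ∨ e • u.ends = u.inv.ends ∧ e • u.inv.ends = u.ends := by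
  rw [maxLoxodromic, MulAction.mem_stabilizer_iff, u.limitSet_eq, ← Set.image_smul,
    Set.image_pair,
    Set.pair_eq_pair_iff] at he
  exact he

/-- Two isometries which exchange the ends have a product which fixes them. -/
lemma mul_mem_pointStab {a b : G} (ha : a ∈ maxLoxodromic X u.g) (hb : b ∈ maxLoxodromic X u.g)
    (ha' : a ∉ u.pointStab) (hb' : b ∉ u.pointStab) : a * b ∈ u.pointStab := by
  obtain ⟨a1, a2⟩ := (u.mem_pointStab_or ha).resolve_left ha'
  obtain ⟨b1, b2⟩ := (u.mem_pointStab_or hb).resolve_left hb'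
  constructor
  · change (a * b) • u.ends = u.ends
    rw [mul_smul, b1, a2]
  · change (a * b) • u.inv.ends = u.inv.ends
    rw [mul_smul, b2, a1]

lemma sq_mem_pointStab {e : G} (he : e ∈ maxLoxodromic X u.g) : e ^ 2 ∈ u.pointStab := by
  by_cases h : e ∈ u.pointStab
  · exact pow_mem h 2
  · rw [pow_two]
    exact u.mul_mem_pointStab he he h h

lemma conj_mem_pointStab {e f : G} (he : e ∈ maxLoxodromic X u.g) (hf : f ∈ u.pointStab) :
    e * f * e⁻¹ ∈ u.pointStab := by
  have key : e⁻¹ ∉ u.pointStab → e ∉ u.pointStab := fun h h' => h (inv_mem h')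
  by_cases h : e⁻¹ ∈ u.pointStab
  · exact mul_mem (mul_mem (by simpa using inv_mem h) hf) h
  · refine u.mul_mem_pointStab (mul_mem he (u.pointStab_le hf)) (inv_mem he) (fun h' => ?_) h
    exact key h ((Subgroup.mul_mem_cancel_right _ hf).1 h')

/-- The isometries of finite order which fix both ends form a finite subgroup, and those of infinite
order have a power in common with `u`. -/
lemma exists_torsion (hacyl : IsAcylindrical G X) :
    (∃ T : Subgroup G, Finite T ∧ ∀ f, f ∈ T ↔ f ∈ u.pointStab ∧ IsOfFinOrder f) ∧
      ∀ f ∈ u.pointStab, ¬ IsOfFinOrder f →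
        limitSet X (Subgroup.zpowers f) = limitSet X (Subgroup.zpowers u.g) := by
  obtain ⟨N, hN, S, hS, hcomm⟩ := u.exists_commute_pow hacyl
  set z : u.pointStab := ⟨u.g ^ N, pow_mem u.mem_pointStab N⟩ with hz
  have hS' : (⋃ r ∈ Set.Ico (0 : ℤ) N, (fun s => u.g ^ (-r) * s) '' S).Finite :=
    (Set.finite_Ico _ _).biUnion fun r _ => hS.image _
  obtain ⟨⟨T, hT, hT'⟩, hlox⟩ := exists_torsion_subgroup (z := z)
    (fun p => Subtype.ext (hcomm p.1 p.2).1.eq)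
    (fun h => u.not_isOfFinOrder ((isOfFinOrder_pow.1
      ((Submonoid.isOfFinOrder_coe (H := u.pointStab.toSubmonoid) (x := z)).2 h)).resolve_right
        hN.ne'))
    (hS'.preimage Subtype.val_injective.injOn) (fun p => by
      obtain ⟨j, hj⟩ := (hcomm p.1 p.2).2
      refine ⟨j / N, ?_⟩
      have hN' : (0 : ℤ) < N := by exact_mod_cast hN
      simp only [Set.mem_preimage, Set.mem_iUnion]
      refine ⟨j % N, ⟨Int.emod_nonneg _ hN'.ne', Int.emod_lt_of_pos _ hN'⟩, _, hj, ?_⟩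
      change u.g ^ (-(j % (N : ℤ))) * (u.g ^ j * p.1) = (u.g ^ N) ^ (j / (N : ℤ)) * p.1
      rw [← zpow_natCast, ← zpow_mul, ← mul_assoc, ← zpow_add, Int.emod_def]
      congr 2
      ring)
  refine ⟨⟨T.map u.pointStab.subtype, ?_, fun f => ?_⟩, fun f hf hfin => ?_⟩
  · exact ((Set.toFinite (T : Set u.pointStab)).image u.pointStab.subtype).to_subtype
  · rw [Subgroup.mem_map]
    constructor
    · rintro ⟨p, hp, rfl⟩
      exact ⟨p.2, (Submonoid.isOfFinOrder_coe (H := u.pointStab.toSubmonoid) (x := p)).2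
        ((hT' p).1 hp)⟩
    · rintro ⟨hf, hfin⟩
      exact ⟨⟨f, hf⟩, (hT' _).2 ((Submonoid.isOfFinOrder_coe (H := u.pointStab.toSubmonoid)
        (x := ⟨f, hf⟩)).1 hfin), rfl⟩
  · obtain ⟨k, i, hk, hi, h⟩ := hlox ⟨f, hf⟩ fun h => hfin
      ((Submonoid.isOfFinOrder_coe (H := u.pointStab.toSubmonoid) (x := ⟨f, hf⟩)).2 h)
    have h' : f ^ (k : ℤ) = u.g ^ ((N : ℤ) * i) := by
      have := congrArg Subtype.val h
      rw [zpow_mul, zpow_natCast, zpow_natCast]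
      exact this
    rw [← limitSet_zpowers_zpow f (Nat.cast_ne_zero.2 hk), h',
      limitSet_zpowers_zpow _ (mul_ne_zero (Nat.cast_ne_zero.2 hN.ne') hi)]

/-- The maximal loxodromic subgroup is elementary. -/
lemma isElementary_maxLoxodromic (hacyl : IsAcylindrical G X) :
    IsElementary X (maxLoxodromic X u.g) := by
  obtain ⟨N, hN, S, hS, hcomm⟩ := u.exists_commute_pow hacyl
  have key : ∀ S' : Set G, S'.Finite →
      (∀ e ∈ maxLoxodromic X u.g, ∃ j : ℤ, u.g ^ j * e ∈ S') →
      IsElementary X (maxLoxodromic X u.g) := by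
    intro S' hS' h
    refine (Set.encard_le_encard (limitSet_subset_of_finite (H := Subgroup.zpowers u.g)
      hS' fun e he => ?_)).trans u.encard_limitSet.le
    obtain ⟨j, hj⟩ := h e he
    exact ⟨u.g ^ (-j), Subgroup.zpow_mem_zpowers _ _, by simpa using hj⟩
  by_cases hex : ∃ e₀ ∈ maxLoxodromic X u.g, e₀ ∉ u.pointStab
  · obtain ⟨e₀, he₀, he₀'⟩ := hex
    refine key (S ∪ (fun s => s * e₀) '' S) (hS.union (hS.image _)) fun e he => ?_
    by_cases h : e ∈ u.pointStab
    · obtain ⟨j, hj⟩ := (hcomm e h).2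
      exact ⟨j, .inl hj⟩
    · obtain ⟨j, hj⟩ := (hcomm _ (u.mul_mem_pointStab he (inv_mem he₀) h
        fun h' => he₀' (by simpa using inv_mem h'))).2
      exact ⟨j, .inr ⟨_, hj, by simp [mul_assoc]⟩⟩
  · push Not at hex
    exact key S hS fun e he => (hcomm e (hex e he)).2

/-- If an isometry conjugates one isometry of infinite order fixing the ends of `u` to another one,
it preserves the set of these ends. -/
lemma mem_maxLoxodromic_of_conj (hacyl : IsAcylindrical G X) {v h : G} (hv : v ∈ u.pointStab)
    (hv' : h⁻¹ * v * h ∈ u.pointStab) (hinf : ¬ IsOfFinOrder v) : h ∈ maxLoxodromic X u.g := by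
  have h1 := (u.exists_torsion hacyl).2 v hv hinf
  have h2 := (u.exists_torsion hacyl).2 _ hv' fun hfin => hinf (by
    obtain ⟨n, hn, hp⟩ := isOfFinOrder_iff_pow_eq_one.1 hfin
    refine isOfFinOrder_iff_pow_eq_one.2 ⟨n, hn, ?_⟩
    have e : v = h * (h⁻¹ * v * h) * h⁻¹ := by simp [mul_assoc]
    rw [e, conj_pow, hp]
    simp)
  have h3 := smul_limitSet_zpowers (X := X) h⁻¹ v
  rw [inv_inv, h1, h2] at h3
  rw [← inv_mem_iff]
  exact MulAction.mem_stabilizer_iff.2 h3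

end LongIsometry

end MaximalLoxodromic

/-! ### Elementary subgroups generated by conjugates -/

lemma exists_card_eq_four {G : Type*} [Group G] {a b : G} (ha : a ^ 2 = 1) (hb : b ^ 2 = 1)
    (hab : Commute a b) (ha1 : a ≠ 1) (hb1 : b ≠ 1) (hne : a ≠ b) :
    ∃ K : Subgroup G, Nat.card K = 4 := by
  have ha' : a * a = 1 := by rw [← pow_two, ha]
  have hb' : b * b = 1 := by rw [← pow_two, hb]
  have haa : ∀ c, a * (a * c) = c := fun c => by rw [← mul_assoc, ha', one_mul]
  have hba : b * a = a * b := hab.eq.symm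
  have hbac : ∀ c, b * (a * c) = a * (b * c) := fun c => by rw [← mul_assoc, hba, mul_assoc]
  let K : Subgroup G :=
    { carrier := {1, a, b, a * b}
      one_mem' := by simp
      mul_mem' := by
        rintro x y (rfl | rfl | rfl | rfl) (rfl | rfl | rfl | rfl) <;>
          simp [mul_assoc, ha', hb', haa, hba, hbac]
      inv_mem' := by
        have ia : a⁻¹ = a := inv_eq_of_mul_eq_one_left ha'
        have ib : b⁻¹ = b := inv_eq_of_mul_eq_one_left hb'
        rintro x (rfl | rfl | rfl | rfl) <;> simp [ia, ib, hba] }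
  refine ⟨K, ?_⟩
  change ({1, a, b, a * b} : Set G).ncard = 4
  have hab1 : 1 ≠ a * b := fun h => hne (by
    have := congrArg (a * ·) h
    simpa [haa] using this)
  rw [Set.ncard_eq_succ (by simp)]
  refine ⟨1, {a, b, a * b}, ?_, rfl, ?_⟩
  · simp [ha1.symm, hb1.symm, hab1]
  · rw [Set.ncard_eq_three]
    exact ⟨a, b, a * b, hne, by simp [hb1], by simp [ha1], rfl⟩

section Tame

variable {G : Type v} [Group G] {X : Type u} [MetricSpace X] [MulAction G X] {δ : ℝ}

lemma exists_nuProperty_le_tau (hnu : nu G X ≠ ⊤) : ∃ m ≤ tau G X, NuProperty G X m := by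
  classical
  have hex : ∃ m, 0 < m ∧ NuProperty G X m := by
    by_contra! h
    refine hnu ?_
    simp only [nu, iInf_eq_top]
    exact fun m hm hm' => absurd hm' (h m hm)
  have : nu G X = (Nat.find hex : ℕ∞) := by
    refine le_antisymm ?_ ?_
    · exact iInf_le_of_le _ (iInf_le_of_le (Nat.find_spec hex).1
        (iInf_le_of_le (Nat.find_spec hex).2 le_rfl))
    · exact le_iInf fun m => le_iInf fun hm => le_iInf fun hm' =>
        Nat.cast_le.2 (Nat.find_min' hex ⟨hm, hm'⟩)
  refine ⟨Nat.find hex, ?_, (Nat.find_spec hex).2⟩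
  rw [tau, this]
  exact le_max_left _ _

variable [IsIsometricSMul G X]

namespace LongIsometry

variable (u : LongIsometry G δ X)

/-- In a tame action, if some isometry of finite order exchanges the ends of `u`, it is an
involution, and no non-trivial isometry of finite order fixes them: otherwise there would be a
subgroup of order `4`. -/
lemma sq_eq_one_of_isTame (hacyl : IsAcylindrical G X) (htame : IsTame G X) {e : G}
    (he : e ∈ maxLoxodromic X u.g) (he' : e ∉ u.pointStab) (hfin : IsOfFinOrder e) :
    e ^ 2 = 1 ∧ ∀ f ∈ u.pointStab, IsOfFinOrder f → f = 1 := by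
  obtain ⟨T, hT, hmem⟩ := (u.exists_torsion hacyl).1
  have hTE : T ≤ maxLoxodromic X u.g := fun f hf => u.pointStab_le ((hmem f).1 hf).1
  have hconj : ∀ a ∈ maxLoxodromic X u.g, ∀ f ∈ T, a * f * a⁻¹ ∈ T := fun a ha f hf =>
    (hmem _).2 ⟨u.conj_mem_pointStab ha ((hmem f).1 hf).1, by
      obtain ⟨n, hn, hp⟩ := isOfFinOrder_iff_pow_eq_one.1 ((hmem f).1 hf).2
      exact isOfFinOrder_iff_pow_eq_one.2 ⟨n, hn, by rw [conj_pow, hp]; simp⟩⟩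
  have hcard : Nat.card T ≤ 2 := by
    rw [← Nat.card_congr (Subgroup.subgroupOfEquivOfLe hTE).toEquiv]
    refine htame.2 u.g u.isLoxodromic _ ⟨fun f hf a => ?_⟩ ?_
    · rw [Subgroup.mem_subgroupOf] at hf ⊢
      exact hconj a a.2 f hf
    · exact Finite.of_equiv T (Subgroup.subgroupOfEquivOfLe hTE).toEquiv.symm
  have heq : ∀ s ∈ T, ∀ t ∈ T, s ≠ 1 → t ≠ 1 → s = t := by
    intro s hs t ht hs1 ht1
    by_contra hne
    have h3 : ({1, s, t} : Set G).ncard = 3 :=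
      Set.ncard_eq_three.2 ⟨1, s, t, hs1.symm, ht1.symm, hne, rfl⟩
    have h4 : ({1, s, t} : Set G) ⊆ T := by
      rintro _ (rfl | rfl | rfl)
      exacts [T.one_mem, hs, ht]
    have h5 := Set.ncard_le_ncard h4 (Set.toFinite (T : Set G))
    rw [h3] at h5
    have h6 : (T : Set G).ncard = Nat.card T := rfl
    omega
  have hsq : ∀ t ∈ T, t ^ 2 = 1 := by
    intro t ht
    by_contra hne
    have ht1 : t ≠ 1 := by rintro rfl; simp at hne
    have := heq _ (pow_mem ht 2) t ht hne ht1
    rw [pow_two, mul_eq_left] at this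
    exact ht1 this
  have he2 : e ^ 2 ∈ T := (hmem _).2 ⟨u.sq_mem_pointStab he, hfin.pow⟩
  have he1 : e ^ 2 = 1 := by
    by_contra hne
    have h4 : (e ^ 2) ^ 2 = 1 := hsq _ he2
    rw [← pow_mul] at h4
    have : orderOf e = 4 := orderOf_eq_prime_pow (p := 2) (n := 1) (by simpa using hne) h4
    exact htame.1 (Subgroup.zpowers e) (by rw [Nat.card_zpowers, this])
  refine ⟨he1, fun t ht htfin => ?_⟩
  have htT := (hmem t).2 ⟨ht, htfin⟩
  by_contra ht1
  have hc : e * t * e⁻¹ = t := heq _ (hconj e he t htT) t htT (by simpa using ht1) ht1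
  have hcomm : Commute e t := mul_inv_eq_iff_eq_mul.1 hc
  obtain ⟨K, hK⟩ := exists_card_eq_four he1 (hsq t htT) hcomm
    (by rintro rfl; exact he' u.pointStab.one_mem) ht1 (by rintro rfl; exact he' ht)
  exact htame.1 K hK

end LongIsometry

/-- Let `H` be generated by conjugates of `g` by successive powers of `h`, at least three of them.
If `H` is elementary and has unbounded orbits, then `g` and `h` preserve its limit set. -/
lemma IsTame.isElementary_of_not_isElliptic (hacyl : IsAcylindrical G X) (htame : IsTame G X)
    (hX : IsHyperbolic δ X) (hlen : IsLengthSpace X) (hδ : 0 < δ) {g h : G} {m : ℕ} (hm : 2 ≤ m)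
    (helem : IsElementary X (Subgroup.closure (Set.range fun i : Fin (m + 1) =>
      (h ^ (i : ℕ))⁻¹ * g * h ^ (i : ℕ))))
    (hell : ¬ IsElliptic X (Subgroup.closure (Set.range fun i : Fin (m + 1) =>
      (h ^ (i : ℕ))⁻¹ * g * h ^ (i : ℕ)))) :
    IsElementary X (Subgroup.closure {g, h}) := by
  set H := Subgroup.closure (Set.range fun i : Fin (m + 1) =>
      (h ^ (i : ℕ))⁻¹ * g * h ^ (i : ℕ)) with hH
  obtain ⟨u, hu⟩ := hacyl.exists_long hX hlen hδ hell
  have hHE := u.le_maxLoxodromic helem hu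
  have hgH : ∀ i ≤ m, (h ^ i)⁻¹ * g * h ^ i ∈ H := fun i hi =>
    Subgroup.subset_closure ⟨⟨i, by omega⟩, rfl⟩
  have hg : g ∈ H := by simpa using hgH 0 (by omega)
  have hg1 : h⁻¹ * g * h ∈ H := by simpa using hgH 1 (by omega)
  have hfinconj : ∀ a b : G, IsOfFinOrder a → IsOfFinOrder (b⁻¹ * a * b) := by
    intro a b hab
    obtain ⟨n, hn, hp⟩ := isOfFinOrder_iff_pow_eq_one.1 hab
    refine isOfFinOrder_iff_pow_eq_one.2 ⟨n, hn, ?_⟩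
    have := conj_pow (i := n) (a := b⁻¹) (b := a)
    rw [inv_inv] at this
    rw [this, hp]
    simp
  have hhE : h ∈ maxLoxodromic X u.g := by
    by_cases hfin : IsOfFinOrder g
    · by_cases hall : ∀ i ≤ m, (h ^ i)⁻¹ * g * h ^ i ∈ u.pointStab
      · refine absurd ?_ hell
        obtain ⟨T, hT, hmem⟩ := (u.exists_torsion hacyl).1
        refine IsElliptic.mono (K := T) ?_ (isElliptic_of_finite (Set.toFinite _))
        rw [hH, Subgroup.closure_le]
        rintro _ ⟨i, rfl⟩
        exact (hmem _).2 ⟨hall i (by omega), hfinconj _ _ hfin⟩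
      · push Not at hall
        obtain ⟨i, hi, hi'⟩ := hall
        obtain ⟨-, htriv⟩ := u.sq_eq_one_of_isTame hacyl htame (hHE (hgH i hi)) hi'
          (hfinconj _ _ hfin)
        have hg_ne : g ≠ 1 := by
          rintro rfl
          exact hi' (by simp)
        have hswap : ∀ j ≤ m, (h ^ j)⁻¹ * g * h ^ j ∉ u.pointStab := by
          intro j hj hj'
          have := htriv _ hj' (hfinconj _ _ hfin)
          apply hg_ne
          rwa [mul_assoc, inv_mul_eq_one, right_eq_mul] at this
        -- the product of the first two involutions is a translation
        have hv : g * (h⁻¹ * g * h) ∈ u.pointStab :=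
          u.mul_mem_pointStab (hHE hg) (hHE hg1) (by simpa using hswap 0 (by omega))
            (by simpa using hswap 1 (by omega))
        refine u.mem_maxLoxodromic_of_conj hacyl hv ?_ ?_
        · have := u.mul_mem_pointStab (hHE hg1) (hHE (hgH 2 hm))
            (by simpa using hswap 1 (by omega)) (hswap 2 hm)
          simpa [pow_two, mul_assoc] using this
        · intro hvfin
          have hsq := (u.sq_eq_one_of_isTame hacyl htame (hHE hg)
            (by simpa using hswap 0 (by omega)) hfin).1
          have h1 := htriv _ hv hvfin
          have h2 : h⁻¹ * g * h = g := by
            rw [pow_two] at hsq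
            exact mul_left_cancel (a := g) (by rw [h1, hsq])
          have hcomm : Commute h g := by
            rw [mul_assoc, inv_mul_eq_iff_eq_mul] at h2
            exact h2.symm
          refine absurd ?_ hell
          refine IsElliptic.mono (K := Subgroup.zpowers g) ?_ (isElliptic_of_finite ?_)
          · rw [hH, Subgroup.closure_le]
            rintro _ ⟨j, rfl⟩
            change (h ^ (j : ℕ))⁻¹ * g * h ^ (j : ℕ) ∈ Subgroup.zpowers g
            rw [mul_assoc, ← (hcomm.pow_left j).eq, inv_mul_cancel_left]
            exact Subgroup.mem_zpowers g
          · have := hfin.finite_zpowers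
            exact this
    · refine u.mem_maxLoxodromic_of_conj hacyl (u.sq_mem_pointStab (hHE hg)) ?_
        fun hfin' => hfin ((isOfFinOrder_pow.1 hfin').resolve_right two_ne_zero)
      have := u.sq_mem_pointStab (hHE hg1)
      simpa [pow_two, mul_assoc] using this
  refine IsElementary.mono ?_ (u.isElementary_maxLoxodromic hacyl)
  rw [Subgroup.closure_le]
  rintro _ (rfl | rfl)
  exacts [hHE hg, hhE]

/-- If sufficiently many conjugates of `g` by the successive powers of a loxodromic element `h`
generate an elementary subgroup, then so do `g` and `h`. -/
lemma IsTame.isElementary_of_conj (hacyl : IsAcylindrical G X) (htame : IsTame G X)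
    (hX : IsHyperbolic δ X) (hlen : IsLengthSpace X) (hδ : 0 < δ) (hnu : nu G X ≠ ⊤)
    {g h : G} {m : ℕ} (hh : IsLoxodromic X h) (hm : tau G X ≤ m)
    (helem : IsElementary X (Subgroup.closure (Set.range fun i : Fin (m + 1) =>
      (h ^ (i : ℕ))⁻¹ * g * h ^ (i : ℕ)))) :
    IsElementary X (Subgroup.closure {g, h}) := by
  have h3 : 3 ≤ tau G X := le_max_right _ _
  by_cases hell : IsElliptic X (Subgroup.closure (Set.range fun i : Fin (m + 1) =>
      (h ^ (i : ℕ))⁻¹ * g * h ^ (i : ℕ)))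
  · obtain ⟨m₀, hm₀, hprop⟩ := exists_nuProperty_le_tau hnu
    refine hprop g h hh (hell.mono (Subgroup.closure_mono ?_))
    rintro _ ⟨i, rfl⟩
    exact ⟨⟨i, by omega⟩, rfl⟩
  · exact htame.isElementary_of_not_isElliptic hacyl hX hlen hδ (by omega) helem hell

end Tame

/-! ### Short isometries and tuples of axes -/

section Overlap

variable {G : Type v} [Group G] {X : Type u} [MetricSpace X] [MulAction G X] {δ : ℝ}

/-- All that matters about `L_S` is that it is larger than `500`. -/
lemma isShort_of_le {g : G} (hg : transLength X g ≤ 500 * δ) : IsShort X δ g := by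
  have h1 : (500 : ℕ∞) ≤ LS.{u} δ :=
    le_iInf fun n => le_iInf fun hn => le_iInf fun _ => by exact_mod_cast hn.le
  have h2 : (500 : ℝ≥0∞) ≤ (LS.{u} δ : ℝ≥0∞) := by
    have := ENat.toENNReal_le.2 h1
    simpa using this
  calc ENNReal.ofReal (transLength X g) ≤ ENNReal.ofReal (500 * δ) := ENNReal.ofReal_le_ofReal hg
    _ = 500 * ENNReal.ofReal δ := by rw [ENNReal.ofReal_mul (by norm_num), ENNReal.ofReal_ofNat]
    _ ≤ _ := by gcongr

lemma overlap_pair_comm (g h : G) : overlap X δ ![g, h] = overlap X δ ![h, g] := by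
  unfold overlap
  congr 1
  ext x
  simp only [Set.mem_iInter, Fin.forall_fin_two, Matrix.cons_val_zero, Matrix.cons_val_one]
  exact and_comm

lemma overlap_le_pair {m : ℕ} (g : Fin m → G) (i j : Fin m) :
    overlap X δ g ≤ overlap X δ ![g i, g j] := by
  refine Metric.ediam_mono fun x hx => ?_
  rw [Set.mem_iInter] at hx ⊢
  exact Fin.forall_fin_two.2 ⟨hx i, hx j⟩

lemma edist_le_overlap {m : ℕ} {g : Fin m → G} {x y : X}
    (hx : ∀ i, x ∈ Metric.cthickening (13 * δ) (axis X δ (g i)))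
    (hy : ∀ i, y ∈ Metric.cthickening (13 * δ) (axis X δ (g i))) :
    edist x y ≤ overlap X δ g :=
  Metric.edist_le_ediam_of_mem (Set.mem_iInter.2 hx) (Set.mem_iInter.2 hy)

/-- To bound `A(g, h)`, it suffices to bound the distance of any two points that are close to points
of both axes. -/
lemma overlap_pair_le (hδ : 0 < δ) {g h : G} {c : ℝ≥0∞}
    (H : ∀ x y : X, ∀ xg ∈ axis X δ g, ∀ yg ∈ axis X δ g, ∀ xh ∈ axis X δ h, ∀ yh ∈ axis X δ h,
      dist x xg ≤ 14 * δ → dist y yg ≤ 14 * δ → dist x xh ≤ 14 * δ → dist y yh ≤ 14 * δ →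
      edist x y ≤ c) : overlap X δ ![g, h] ≤ c := by
  refine Metric.ediam_le fun x hx y hy => ?_
  rw [Set.mem_iInter, Fin.forall_fin_two] at hx hy
  obtain ⟨xg, hxg, hxg'⟩ := exists_mem_axis_of_mem_cthickening hδ hx.1
  obtain ⟨xh, hxh, hxh'⟩ := exists_mem_axis_of_mem_cthickening hδ hx.2
  obtain ⟨yg, hyg, hyg'⟩ := exists_mem_axis_of_mem_cthickening hδ hy.1
  obtain ⟨yh, hyh, hyh'⟩ := exists_mem_axis_of_mem_cthickening hδ hy.2
  exact H x y xg hxg yg hyg xh hxh yh hyh hxg' hyg' hxh' hyh'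

/-- A short tuple with at most `τ + 1` entries generating a non-elementary subgroup can be
completed by repeating its last entry, so that its overlap is at most `Ω`. -/
lemma overlap_le_Omega {m : ℕ} (hm : m ≤ tau G X) (g : Fin (m + 1) → G)
    (hg : ¬ IsElementary X (Subgroup.closure (Set.range g))) (hshort : ∀ j, IsShort X δ (g j)) :
    overlap X δ g ≤ Omega G X δ := by
  set φ : Fin (tau G X + 1) → Fin (m + 1) := fun i => ⟨min i m, by omega⟩ with hφ
  have hsurj : Function.Surjective φ := fun i => ⟨⟨i, by omega⟩, Fin.ext (by simp [hφ]; omega)⟩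
  have h1 : overlap X δ g = overlap X δ (g ∘ φ) := by
    unfold overlap
    rw [← hsurj.iInter_comp]
    rfl
  rw [h1]
  refine le_iSup_of_le (g ∘ φ) (le_iSup_of_le ?_ (le_iSup_of_le (fun j => hshort _) le_rfl))
  rwa [hsurj.range_comp]

variable [IsIsometricSMul G X]

lemma mem_cthickening_axis_conj {g c : G} {r : ℝ} {x : X} :
    x ∈ Metric.cthickening r (axis X δ (c⁻¹ * g * c)) ↔
      c • x ∈ Metric.cthickening r (axis X δ g) := by
  have h : axis X δ g = c • axis X δ (c⁻¹ * g * c) := by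
    ext y
    rw [Set.mem_smul_set_iff_inv_smul_mem]
    simp only [axis, Set.mem_ofPred_eq, transLength_conj]
    rw [← dist_smul c (c⁻¹ • y)]
    simp [smul_smul, mul_assoc]
  rw [Metric.mem_cthickening_iff, Metric.mem_cthickening_iff, h, Metric.infEDist_smul]

/-! ### Translating along a common axis -/

/-- Near its axis, an isometry `h` with large translation length translates, as do its powers,
towards `y` or away from `y`; in the second case, `h⁻¹` translates towards `y`. -/
lemma IsHyperbolic.exists_oriented (hX : IsHyperbolic δ X) (hlen : IsLengthSpace X) (hδ : 0 < δ)
    {h : G} (hh : 10 * δ < transLength X h) {x : X} (hx : dist x (h • x) ≤ transLength X h + 36 * δ)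
    (y : X) : ∃ k : G, (k = h ∨ k = h⁻¹) ∧
      ∀ n : ℕ, dist x y + dist x (k ^ n • x) - 46 * δ ≤ dist x (k ^ n • y) := by
  by_cases H : ∀ n : ℕ, gromovProd x (h⁻¹ ^ n • x) y ≤ 23 * δ
  · refine ⟨h, .inl rfl, fun n => ?_⟩
    have := H n
    unfold gromovProd at this
    rw [← dist_smul (h ^ n) (h⁻¹ ^ n • x) y, inv_pow, smul_inv_smul, dist_comm _ x,
      dist_inv_smul_eq, dist_comm y x] at this
    linarith
  · push Not at H
    obtain ⟨m, hm⟩ := H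
    refine ⟨h⁻¹, .inr rfl, fun n => ?_⟩
    have h1 := hX.gromovProd_inv_pow_le hlen hδ hh x m n
    have h2 := (hX.le_or_le_of_gromovProd_le (y := y) (c := 22 * δ)
      (show gromovProd x (h⁻¹ ^ m • x) (h ^ n • x) ≤ 22 * δ by linarith)).resolve_left (by linarith)
    unfold gromovProd at h2
    rw [← dist_smul (h ^ n)⁻¹ y (h ^ n • x), inv_smul_smul, dist_comm _ x, dist_comm _ x,
      dist_comm _ x] at h2
    rw [inv_pow, dist_inv_smul_eq]
    linarith

/-- If `x` and `y` are close to the axes of `g` and `h`, and the powers of `h` translate `x`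
towards `y`, then any point almost between `x` and `y`, and far enough from `x` and `y`, is mapped
close to the axis of `g` by `hⁱ`. -/
lemma IsHyperbolic.pow_smul_mem_cthickening_axis (hX : IsHyperbolic δ X) (hlen : IsLengthSpace X)
    (hδ : 0 < δ) {g h : G} (hh : 10 * δ < transLength X h) {x y xg yg xh yh w : X}
    (hxg : xg ∈ axis X δ g) (hyg : yg ∈ axis X δ g) (hxh : xh ∈ axis X δ h)
    (hyh : yh ∈ axis X δ h) (dxg : dist x xg ≤ 14 * δ) (dyg : dist y yg ≤ 14 * δ)
    (dxh : dist x xh ≤ 14 * δ) (dyh : dist y yh ≤ 14 * δ)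
    (hor : ∀ n : ℕ, dist x y + dist x (h ^ n • x) - 46 * δ ≤ dist x (h ^ n • y))
    (hw : gromovProd w x y ≤ δ) {i N : ℕ} (hi : i ≤ N) (hxw : 42 * δ ≤ dist x w)
    (hyw : N * transLength X h + 66 * δ ≤ dist y w) :
    h ^ i • w ∈ Metric.cthickening (13 * δ) (axis X δ g) := by
  set p := h ^ i • w with hp
  have ex := hX.dist_pow_smul_le_of_dist_axis_le hlen hδ hh hxh dxh i
  have ey := hX.dist_pow_smul_le_of_dist_axis_le hlen hδ hh hyh dyh i
  have hiN : i * transLength X h ≤ N * transLength X h :=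
    mul_le_mul_of_nonneg_right (by exact_mod_cast hi) (transLength_nonneg h)
  have h1 : gromovProd p (h ^ i • x) (h ^ i • y) ≤ δ := by
    rw [gromovProd_smul, hp, inv_smul_smul]; exact hw
  have e1 : dist (h ^ i • x) p = dist x w := by rw [hp, dist_smul]
  have e2 : dist (h ^ i • y) p = dist y w := by rw [hp, dist_smul]
  have t1 := dist_triangle x p (h ^ i • y)
  have t2 := dist_triangle x (h ^ i • x) p
  have t3 := dist_triangle x p y
  have t4 := dist_triangle x xg p
  have t5 := dist_triangle y yg p
  have t6 := dist_triangle_left (h ^ i • x) xg x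
  have t7 := dist_triangle_left (h ^ i • y) yg y
  have c1 := dist_comm p (h ^ i • y)
  have c2 := dist_comm p y
  have hor' := hor i
  have hw' := hw
  unfold gromovProd at hw'
  have h2 : δ + 2 * δ < gromovProd p (h ^ i • x) xg := by
    unfold gromovProd; linarith
  have h3 : δ + 2 * δ < gromovProd p (h ^ i • y) yg := by
    unfold gromovProd; linarith
  exact hX.mem_cthickening_axis hlen hδ hxg hyg
    ((hX.gromovProd_le_of_lt hδ h1 h2 h3).trans (by linarith))

/-- How an isometry moves a point `w` almost between `x` and `y` when it translates `x` and `y`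
in the direction from `x` to `y`. -/
lemma IsHyperbolic.smul_between (hX : IsHyperbolic δ X) (hδ : 0 < δ) {g : G} {x y w : X} {c : ℝ}
    (hx : dist x (g • x) ≤ transLength X g + 36 * δ)
    (hy : dist y (g • y) ≤ transLength X g + 36 * δ)
    (hor : dist x y + transLength X g - 46 * δ ≤ dist x (g • y)) (hw : gromovProd w x y ≤ c)
    (hxw : 43 * δ + 2 * c < dist x w) (hyw : transLength X g + 38 * δ + 2 * c < dist y w) :
    dist x (g • w) ≤ dist x w + transLength X g + 36 * δ ∧
      dist x w + transLength X g - 46 * δ - 2 * c ≤ dist x (g • w) ∧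
      gromovProd (g • w) x y ≤ c + 2 * δ := by
  have e1 : dist (g • x) (g • w) = dist x w := dist_smul _ _ _
  have e2 : dist (g • y) (g • w) = dist y w := dist_smul _ _ _
  have t1 := dist_triangle x (g • x) (g • w)
  have t2 := dist_triangle x (g • w) (g • y)
  have t3 := dist_triangle x (g • w) y
  have c1 := dist_comm (g • w) (g • y)
  have c2 := dist_comm (g • w) y
  have c3 := dist_comm (g • x) x
  have c4 := dist_comm (g • y) y
  have hw' := hw
  unfold gromovProd at hw'
  refine ⟨by linarith, by linarith, ?_⟩
  refine hX.gromovProd_le_of_lt hδ (x := g • x) (y := g • y) (c := c) ?_ ?_ ?_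
  · rw [gromovProd_smul, inv_smul_smul]; exact hw
  · unfold gromovProd; linarith
  · unfold gromovProd; linarith

/-- If `g` and `h` both translate along the segment from `x` to `y`, in the same direction, their
commutator almost fixes the points of this segment far enough from `x` and `y`. -/
lemma IsHyperbolic.dist_commutator_smul_le (hX : IsHyperbolic δ X) (hδ : 0 < δ) {g h : G}
    {x y w : X} (hg500 : 500 * δ < transLength X g) (hh500 : 500 * δ < transLength X h)
    (hxg : dist x (g • x) ≤ transLength X g + 36 * δ)
    (hyg : dist y (g • y) ≤ transLength X g + 36 * δ)
    (hxh : dist x (h • x) ≤ transLength X h + 36 * δ)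
    (hyh : dist y (h • y) ≤ transLength X h + 36 * δ)
    (horg : dist x y + transLength X g - 46 * δ ≤ dist x (g • y))
    (horh : dist x y + transLength X h - 46 * δ ≤ dist x (h • y)) (hw : gromovProd w x y ≤ δ)
    (hxw : 46 * δ ≤ dist x w) (hyw : transLength X g + transLength X h + 84 * δ ≤ dist y w) :
    dist w (((h * g)⁻¹ * (g * h)) • w) ≤ 184 * δ := by
  obtain ⟨g1, g2, g3⟩ := hX.smul_between hδ hxg hyg horg hw (by linarith) (by linarith)
  obtain ⟨h1, h2, h3⟩ := hX.smul_between hδ hxh hyh horh hw (by linarith) (by linarith)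
  have hw' := hw
  unfold gromovProd at hw'
  have t1 := dist_triangle x (g • w) y
  have t2 := dist_triangle x (h • w) y
  have c1 := dist_comm (g • w) y
  have c2 := dist_comm (h • w) y
  obtain ⟨gh1, gh2, gh3⟩ := hX.smul_between hδ hxg hyg horg h3 (by linarith) (by linarith)
  obtain ⟨hg1, hg2, hg3⟩ := hX.smul_between hδ hxh hyh horh g3 (by linarith) (by linarith)
  have e : dist w (((h * g)⁻¹ * (g * h)) • w) = dist (h • g • w) (g • h • w) := by
    rw [← dist_smul (h * g) w, smul_smul, mul_inv_cancel_left, mul_smul, mul_smul]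
  rw [e]
  unfold gromovProd at gh3 hg3
  have d1 := dist_comm (h • g • w) x
  have d2 := dist_comm (g • h • w) x
  have d3 := dist_comm (g • h • w) y
  have d4 := dist_comm (h • g • w) y
  rcases hX.four_point (h • g • w) x (g • h • w) y with H | H <;> linarith

lemma IsLengthSpace.exists_gromovProd_le (hlen : IsLengthSpace X) (hδ : 0 < δ) (x y : X) {t : ℝ}
    (ht : 0 ≤ t) (ht' : t ≤ dist x y) : ∃ w, dist x w = t ∧ dist w y ≤ dist x y - t + 2 * δ ∧
      gromovProd w x y ≤ δ := by
  obtain ⟨w, h1, h2⟩ := hlen.exists_between x y ht ht' (η := 2 * δ) (by linarith)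
  refine ⟨w, h1, h2, ?_⟩
  unfold gromovProd
  rw [dist_comm y w]
  linarith

end Overlap

/-! ### Bounds on the overlap of axes -/

section Bounds

variable {G : Type v} [Group G] {X : Type u} [MetricSpace X] [MulAction G X] [IsIsometricSMul G X]
  {δ : ℝ}

/-- If `g` is short and `h` long, the segments on which the axes of `g` and `h` overlap, shortened by
`τ [h]`, are close to the axes of the conjugates of `g` by the powers of `h` up to `τ`. These
conjugates are short and generate a non-elementary subgroup. -/
lemma IsTame.overlap_le_of_isShort (hδ : 0 < δ) (hX : IsHyperbolic δ X) (hlen : IsLengthSpace X)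
    (hacyl : IsAcylindrical G X) (htame : IsTame G X) (hnu : nu G X ≠ ⊤) {g h : G}
    (hgh : ¬ IsElementary X (Subgroup.closure {g, h})) (hg : IsShort X δ g) :
    overlap X δ ![g, h] ≤
      ENNReal.ofReal (tau G X * transLength X h + 154 * δ) + Omega G X δ := by
  have h3 : 3 ≤ tau G X := le_max_right _ _
  by_cases hh : IsShort X δ h
  · refine (overlap_le_Omega (m := 1) (by omega) ![g, h] ?_ ?_).trans le_add_self
    · rwa [Matrix.range_cons, Matrix.range_cons, Matrix.range_empty, Set.union_empty,
        Set.singleton_union]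
    · exact Fin.forall_fin_two.2 ⟨hg, hh⟩
  have hh500 : 500 * δ < transLength X h := by
    by_contra! hle
    exact hh (isShort_of_le hle)
  have hh10 : 10 * δ < transLength X h := by linarith
  refine overlap_pair_le hδ fun x y xg hxg yg hyg xh hxh yh hyh dxg dyg dxh dyh => ?_
  set τ := tau G X with hτ
  have hτh : 0 ≤ τ * transLength X h := mul_nonneg (Nat.cast_nonneg _) (transLength_nonneg h)
  rcases le_or_gt (dist x y) (τ * transLength X h + 154 * δ) with hle | hlt
  · rw [edist_dist]
    exact (ENNReal.ofReal_le_ofReal hle).trans le_self_add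
  obtain ⟨k, hk, hor⟩ := hX.exists_oriented hlen hδ hh10 (x := x)
    ((dist_smul_le_of_dist_axis_le hxh dxh).trans (by linarith)) y
  have hk' : transLength X k = transLength X h ∧ axis X δ k = axis X δ h := by
    rcases hk with rfl | rfl
    exacts [⟨rfl, rfl⟩, ⟨transLength_inv h, axis_inv h⟩]
  have hmem : ∀ w, gromovProd w x y ≤ δ → 42 * δ ≤ dist x w →
      τ * transLength X h + 66 * δ ≤ dist y w → ∀ i ≤ τ,
        k ^ i • w ∈ Metric.cthickening (13 * δ) (axis X δ g) := fun w h1 h2 h3 i hi =>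
    hX.pow_smul_mem_cthickening_axis hlen hδ (by rwa [hk'.1]) hxg hyg (by rwa [hk'.2])
      (by rwa [hk'.2]) dxg dyg dxh dyh hor h1 hi h2 (by rwa [hk'.1])
  obtain ⟨w₁, a1, a2, a3⟩ := hlen.exists_gromovProd_le hδ x y (t := 42 * δ) (by linarith)
    (by linarith)
  obtain ⟨w₂, b1, b2, b3⟩ := hlen.exists_gromovProd_le hδ x y
    (t := dist x y - τ * transLength X h - 66 * δ) (by linarith) (by linarith)
  have t1 := dist_triangle_right x y w₁
  have t2 := dist_triangle_right x y w₂
  have m1 := hmem w₁ a3 a1.ge (by linarith)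
  have m2 := hmem w₂ b3 (by linarith) (by linarith)
  -- two points, at the same distance as `w₁` and `w₂`, close to the axes of all the conjugates
  obtain ⟨c, hc⟩ : ∃ c : G, ∀ i ≤ τ, ∃ j ≤ τ, h ^ i * c = k ^ j := by
    rcases hk with rfl | rfl
    · exact ⟨1, fun i hi => ⟨i, hi, mul_one _⟩⟩
    · refine ⟨(h ^ τ)⁻¹, fun i hi => ⟨τ - i, Nat.sub_le _ _, ?_⟩⟩
      obtain ⟨l, hl⟩ := Nat.exists_eq_add_of_le hi
      rw [hl, Nat.add_sub_cancel_left, inv_pow, pow_add, mul_inv_rev, ← mul_assoc,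
        (((Commute.refl h).pow_pow i l).inv_right).eq, mul_assoc, mul_inv_cancel, mul_one]
  have hconj : ∀ w, (∀ i ≤ τ, k ^ i • w ∈ Metric.cthickening (13 * δ) (axis X δ g)) →
      ∀ i : Fin (τ + 1), c • w ∈ Metric.cthickening (13 * δ)
        (axis X δ ((h ^ (i : ℕ))⁻¹ * g * h ^ (i : ℕ))) := by
    intro w hw i
    obtain ⟨j, hj, hj'⟩ := hc i (by omega)
    rw [mem_cthickening_axis_conj, smul_smul, hj']
    exact hw j hj
  have hΩ : edist w₁ w₂ ≤ Omega G X δ := by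
    rw [← edist_smul_left c]
    refine (edist_le_overlap (hconj w₁ m1) (hconj w₂ m2)).trans
      (overlap_le_Omega le_rfl _ (fun helem => hgh ?_) fun j => ?_)
    · exact htame.isElementary_of_conj hacyl hX hlen hδ hnu
        (LongIsometry.isLoxodromic ⟨h, x, hh10, hX, hlen, hδ⟩) le_rfl helem
    · unfold IsShort
      rw [transLength_conj]
      exact hg
  have t3 := dist_triangle x w₁ w₂
  calc edist x y ≤ ENNReal.ofReal (τ * transLength X h + 154 * δ + dist w₁ w₂) := by
        rw [edist_dist]
        exact ENNReal.ofReal_le_ofReal (by linarith)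
    _ = ENNReal.ofReal (τ * transLength X h + 154 * δ) + edist w₁ w₂ := by
        rw [ENNReal.ofReal_add (by linarith) dist_nonneg, edist_dist]
    _ ≤ _ := by gcongr

/-- If `h` is long and `h` and the commutator of `g` and `h` generate an elementary subgroup, so do
`g` and `h`. -/
lemma LongIsometry.isElementary_of_commutator (u : LongIsometry G δ X)
    (hacyl : IsAcylindrical G X) {g : G}
    (helem : IsElementary X (Subgroup.closure {(u.g * g)⁻¹ * (g * u.g), u.g})) :
    IsElementary X (Subgroup.closure {g, u.g}) := by
  set K := Subgroup.closure {(u.g * g)⁻¹ * (g * u.g), u.g} with hK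
  have h1 : u.g ∈ K := Subgroup.subset_closure (by simp)
  have h2 : (u.g * g)⁻¹ * (g * u.g) ∈ K := Subgroup.subset_closure (by simp)
  have h3 : g⁻¹ * u.g * g ∈ K := by
    have := mul_mem h1 (inv_mem h2)
    simpa [mul_assoc] using this
  let u' : LongIsometry G δ X :=
    { u with g := g⁻¹ * u.g * g, long := by rw [transLength_conj]; exact u.long }
  have h4 := (u'.limitSet_eq_of_mem helem h3).symm.trans (u.limitSet_eq_of_mem helem h1)
  have h5 := smul_limitSet_zpowers (X := X) g⁻¹ u.g
  rw [inv_inv] at h5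
  have hg : g ∈ maxLoxodromic X u.g := by
    rw [← inv_mem_iff]
    exact MulAction.mem_stabilizer_iff.2 (h5.trans h4)
  refine IsElementary.mono ?_ (u.isElementary_maxLoxodromic hacyl)
  rw [Subgroup.closure_le]
  rintro _ (rfl | rfl)
  exacts [hg, u.pointStab_le u.mem_pointStab]

lemma closure_pair_inv_left (g h : G) :
    Subgroup.closure {g⁻¹, h} = Subgroup.closure ({g, h} : Set G) := by
  apply le_antisymm <;> rw [Subgroup.closure_le] <;> rintro _ (rfl | rfl)
  · exact inv_mem (Subgroup.subset_closure (by simp))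
  · exact Subgroup.subset_closure (by simp)
  · exact inv_mem_iff.1 (Subgroup.subset_closure (by simp))
  · exact Subgroup.subset_closure (by simp)

lemma closure_pair_inv_right (g h : G) :
    Subgroup.closure {g, h⁻¹} = Subgroup.closure ({g, h} : Set G) := by
  rw [Set.pair_comm, closure_pair_inv_left, Set.pair_comm]

/-- If `g` and `h` are both long, their commutator (after replacing them by their inverses if they
translate in different directions) is short, and its axis contains most of the overlap. -/
lemma IsTame.overlap_le_of_long (hδ : 0 < δ) (hX : IsHyperbolic δ X) (hlen : IsLengthSpace X)
    (hacyl : IsAcylindrical G X) (htame : IsTame G X) (hnu : nu G X ≠ ⊤) {g h : G}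
    (hgh : ¬ IsElementary X (Subgroup.closure {g, h})) (hg : 500 * δ < transLength X g)
    (hh : 500 * δ < transLength X h) :
    overlap X δ ![g, h] ≤ ENNReal.ofReal (transLength X g + transLength X h
      + tau G X * transLength X h + 680 * δ) + Omega G X δ := by
  refine overlap_pair_le hδ fun x y xg hxg yg hyg xh hxh yh hyh dxg dyg dxh dyh => ?_
  have hτh : 0 ≤ tau G X * transLength X h := mul_nonneg (Nat.cast_nonneg _) (transLength_nonneg h)
  rcases le_or_gt (dist x y) (transLength X g + transLength X h + 680 * δ) with hle | hlt
  · rw [edist_dist]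
    exact (ENNReal.ofReal_le_ofReal (by linarith)).trans le_self_add
  have dx : ∀ {k : G} {x x' : X}, x' ∈ axis X δ k → dist x x' ≤ 14 * δ →
      dist x (k • x) ≤ transLength X k + 36 * δ := fun h1 h2 =>
    (dist_smul_le_of_dist_axis_le h1 h2).trans (by linarith)
  obtain ⟨g', hg', horg⟩ := hX.exists_oriented hlen hδ (by linarith) (dx hxg dxg) y
  obtain ⟨h', hh', horh⟩ := hX.exists_oriented hlen hδ (by linarith) (dx hxh dxh) y
  have eg : transLength X g' = transLength X g ∧ axis X δ g' = axis X δ g := by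
    rcases hg' with rfl | rfl
    exacts [⟨rfl, rfl⟩, ⟨transLength_inv g, axis_inv g⟩]
  have eh : transLength X h' = transLength X h ∧ axis X δ h' = axis X δ h := by
    rcases hh' with rfl | rfl
    exacts [⟨rfl, rfl⟩, ⟨transLength_inv h, axis_inv h⟩]
  have hgh' : ¬ IsElementary X (Subgroup.closure {g', h'}) := by
    have : Subgroup.closure {g', h'} = Subgroup.closure {g, h} := by
      rcases hg' with rfl | rfl <;> rcases hh' with rfl | rfl <;>
        simp only [closure_pair_inv_left, closure_pair_inv_right]
    rwa [this]
  rw [← eg.2] at hxg hyg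
  rw [← eh.2] at hxh hyh
  rw [← eg.1] at hg hlt ⊢
  rw [← eh.1] at hh hlt hτh ⊢
  set c := (h' * g')⁻¹ * (g' * h') with hc
  have hcomm : ∀ w, gromovProd w x y ≤ δ → 46 * δ ≤ dist x w →
      transLength X g' + transLength X h' + 84 * δ ≤ dist y w →
      ∃ q ∈ axis X δ c, dist w q ≤ 91 * δ ∧ transLength X c ≤ 500 * δ := by
    intro w h1 h2 h3
    have o1 := horg 1
    have o2 := horh 1
    rw [pow_one] at o1 o2
    have h4 := hX.dist_commutator_smul_le hδ hg hh (dx hxg dxg) (dx hyg dyg) (dx hxh dxh)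
      (dx hyh dyh) (by linarith [transLength_le g' x]) (by linarith [transLength_le h' x]) h1 h2 h3
    obtain ⟨q, hq, hq'⟩ := hX.exists_mem_axis hlen hδ c w (r := 91 * δ) (by linarith)
      (by linarith [transLength_nonneg (X := X) c])
    exact ⟨q, hq, hq', (transLength_le c w).trans (by linarith)⟩
  have hg0 := transLength_nonneg (X := X) g'
  have hh0 := transLength_nonneg (X := X) h'
  obtain ⟨w₁, a1, a2, a3⟩ := hlen.exists_gromovProd_le hδ x y (t := 46 * δ) (by linarith)
    (by linarith)
  obtain ⟨w₂, b1, b2, b3⟩ := hlen.exists_gromovProd_le hδ x y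
    (t := dist x y - transLength X g' - transLength X h' - 84 * δ) (by linarith) (by linarith)
  have t1 := dist_triangle_right x y w₁
  have t2 := dist_triangle_right x y w₂
  obtain ⟨q₁, hq₁, dq₁, hcshort⟩ := hcomm w₁ a3 a1.ge (by linarith)
  obtain ⟨q₂, hq₂, dq₂, -⟩ := hcomm w₂ b3 (by linarith) (by linarith)
  have hmem : ∀ p, gromovProd p x y ≤ δ → 142 * δ ≤ dist x p →
      transLength X g' + transLength X h' + 182 * δ ≤ dist y p →
      ∀ i, p ∈ Metric.cthickening (13 * δ) (axis X δ (![c, h'] i)) := by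
    intro p h1 h2 h3
    have key : ∀ {x' y'}, dist x x' + 4 * δ ≤ dist x p → dist y y' + 4 * δ ≤ dist y p →
        gromovProd p x' y' ≤ 9 * δ := fun {x' y'} h4 h5 =>
      (hX.gromovProd_le_of_lt hδ h1 (by linarith [le_gromovProd p x x'])
        (by linarith [le_gromovProd p y y'])).trans (by linarith)
    refine Fin.forall_fin_two.2 ⟨hX.mem_cthickening_axis hlen hδ hq₁ hq₂ (key ?_ ?_),
      hX.mem_cthickening_axis hlen hδ hxh hyh (key ?_ ?_)⟩
    · linarith [dist_triangle x w₁ q₁]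
    · linarith [dist_triangle y w₂ q₂, dist_comm y w₂]
    · linarith
    · linarith
  obtain ⟨p₁, a1', a2', a3'⟩ := hlen.exists_gromovProd_le hδ x y (t := 142 * δ) (by linarith)
    (by linarith)
  obtain ⟨p₂, b1', b2', b3'⟩ := hlen.exists_gromovProd_le hδ x y
    (t := dist x y - transLength X g' - transLength X h' - 182 * δ) (by linarith) (by linarith)
  have t3 := dist_triangle_right x y p₁
  have t4 := dist_triangle_right x y p₂
  have t5 := dist_triangle x p₁ p₂
  have hle := edist_le_overlap (hmem p₁ a3' a1'.ge (by linarith))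
    (hmem p₂ b3' (by linarith) (by linarith))
  have hΩ := htame.overlap_le_of_isShort hδ hX hlen hacyl hnu (g := c) (h := h')
    (fun helem => hgh' (LongIsometry.isElementary_of_commutator
      ⟨h', x, by linarith, hX, hlen, hδ⟩ hacyl helem)) (isShort_of_le hcshort)
  calc edist x y ≤ ENNReal.ofReal ((transLength X g' + transLength X h' + 324 * δ)
        + dist p₁ p₂) := by
        rw [edist_dist]
        exact ENNReal.ofReal_le_ofReal (by linarith)
    _ = ENNReal.ofReal (transLength X g' + transLength X h' + 324 * δ) + edist p₁ p₂ := by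
        rw [ENNReal.ofReal_add (by linarith) dist_nonneg, edist_dist]
    _ ≤ ENNReal.ofReal (transLength X g' + transLength X h' + 324 * δ)
        + (ENNReal.ofReal (tau G X * transLength X h' + 154 * δ) + Omega G X δ) := by
        gcongr
        exact hle.trans hΩ
    _ ≤ _ := by
        rw [← add_assoc, ← ENNReal.ofReal_add (by linarith) (by linarith)]
        gcongr ENNReal.ofReal ?_ + _
        linarith

/-- The bound on the overlap of two axes, without any assumption on the translation lengths. -/
lemma IsTame.overlap_pair_le (hδ : 0 < δ) (hX : IsHyperbolic δ X) (hlen : IsLengthSpace X)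
    (hacyl : IsAcylindrical G X) (htame : IsTame G X) (hnu : nu G X ≠ ⊤) {g h : G}
    (hgh : ¬ IsElementary X (Subgroup.closure {g, h})) :
    overlap X δ ![g, h] ≤ ENNReal.ofReal (transLength X g + transLength X h
      + tau G X * max (transLength X g) (transLength X h) + 680 * δ) + Omega G X δ := by
  have hg0 := transLength_nonneg (X := X) g
  have hh0 := transLength_nonneg (X := X) h
  have hmg : tau G X * transLength X g ≤ tau G X * max (transLength X g) (transLength X h) := by
    gcongr; exact le_max_left _ _
  have hmh : tau G X * transLength X h ≤ tau G X * max (transLength X g) (transLength X h) := by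
    gcongr; exact le_max_right _ _
  by_cases hg : IsShort X δ g
  · refine (htame.overlap_le_of_isShort hδ hX hlen hacyl hnu hgh hg).trans ?_
    gcongr ENNReal.ofReal ?_ + _
    linarith
  by_cases hh : IsShort X δ h
  · rw [overlap_pair_comm]
    rw [Set.pair_comm] at hgh
    refine (htame.overlap_le_of_isShort hδ hX hlen hacyl hnu hgh hh).trans ?_
    gcongr ENNReal.ofReal ?_ + _
    linarith
  refine (htame.overlap_le_of_long hδ hX hlen hacyl hnu hgh ?_ ?_).trans ?_
  · by_contra! hle; exact hg (isShort_of_le hle)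
  · by_contra! hle; exact hh (isShort_of_le hle)
  · gcongr ENNReal.ofReal ?_ + _
    linarith

/-- The bound on the overlap of at most `τ + 1` axes: unless all the entries are short, the tuple
contains two entries, one of which is long, which generate a non-elementary subgroup. -/
lemma IsTame.overlap_le (hδ : 0 < δ) (hX : IsHyperbolic δ X) (hlen : IsLengthSpace X)
    (hacyl : IsAcylindrical G X) (htame : IsTame G X) (hnu : nu G X ≠ ⊤) {m : ℕ}
    (hm : m ≤ tau G X) (g : Fin (m + 1) → G)
    (hg : ¬ IsElementary X (Subgroup.closure (Set.range g))) :
    overlap X δ g ≤ ENNReal.ofReal ((tau G X + 2)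
      * Finset.univ.sup' Finset.univ_nonempty (fun i => transLength X (g i)) + 680 * δ)
      + Omega G X δ := by
  by_cases hshort : ∀ j, IsShort X δ (g j)
  · exact (overlap_le_Omega hm g hg hshort).trans le_add_self
  push Not at hshort
  obtain ⟨i, hi⟩ := hshort
  have hlong : 500 * δ < transLength X (g i) := by
    by_contra! hle; exact hi (isShort_of_le hle)
  have hX' : Nonempty X := by
    by_contra hne
    rw [not_nonempty_iff] at hne
    exact hg (isElementary_of_isEmpty _)
  obtain ⟨x⟩ := hX'
  let u : LongIsometry G δ X := ⟨g i, x, by linarith, hX, hlen, hδ⟩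
  obtain ⟨j, hj⟩ : ∃ j, ¬ IsElementary X (Subgroup.closure {g i, g j}) := by
    by_contra! hcon
    refine hg (IsElementary.mono ?_ (u.isElementary_maxLoxodromic hacyl))
    rw [Subgroup.closure_le]
    rintro _ ⟨j, rfl⟩
    exact u.le_maxLoxodromic (hcon j) (Subgroup.subset_closure (by simp [u]))
      (Subgroup.subset_closure (by simp))
  refine (overlap_le_pair g i j).trans ((htame.overlap_pair_le hδ hX hlen hacyl hnu hj).trans ?_)
  set M := Finset.univ.sup' Finset.univ_nonempty (fun i => transLength X (g i)) with hM
  have hle : ∀ k, transLength X (g k) ≤ M := fun k =>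
    Finset.le_sup' (fun i => transLength X (g i)) (Finset.mem_univ k)
  have h1 : tau G X * max (transLength X (g i)) (transLength X (g j)) ≤ tau G X * M := by
    gcongr
    exact max_le (hle i) (hle j)
  gcongr
  linarith [hle i, hle j]

end Bounds

end HypAct

theorem proposition4p52 {G : Type v} [Group G] {X : Type u} [MetricSpace X] [MulAction G X]
    [IsIsometricSMul G X] (δ : ℝ) (hδ : 0 < δ)
    (hX : HypAct.IsHyperbolic δ X) (hlen : HypAct.IsLengthSpace X)
    (hacyl : HypAct.IsAcylindrical G X) (htame : HypAct.IsTame G X)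
    (hnu : HypAct.nu G X ≠ ⊤) :
    (∀ (g h : G) (m : ℕ), HypAct.IsLoxodromic X h → HypAct.tau G X ≤ m →
      HypAct.IsElementary X (Subgroup.closure (Set.range fun i : Fin (m + 1) =>
        (h ^ (i : ℕ))⁻¹ * g * h ^ (i : ℕ))) →
      HypAct.IsElementary X (Subgroup.closure {g, h})) ∧
    (∀ g h : G, ¬ HypAct.IsElementary X (Subgroup.closure {g, h}) →
      (HypAct.IsShort X δ g →
        HypAct.overlap X δ ![g, h] ≤
          ENNReal.ofReal (HypAct.tau G X * HypAct.transLength X h + 154 * δ)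
            + HypAct.Omega G X δ) ∧
      HypAct.overlap X δ ![g, h] ≤
        ENNReal.ofReal (HypAct.transLength X g + HypAct.transLength X h
            + HypAct.tau G X * max (HypAct.transLength X g) (HypAct.transLength X h) + 680 * δ)
          + HypAct.Omega G X δ) ∧
    (∀ (m : ℕ), m ≤ HypAct.tau G X → ∀ g : Fin (m + 1) → G,
      ¬ HypAct.IsElementary X (Subgroup.closure (Set.range g)) →
      HypAct.overlap X δ g ≤
        ENNReal.ofReal ((HypAct.tau G X + 2)
            * Finset.univ.sup' Finset.univ_nonempty (fun i => HypAct.transLength X (g i))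
            + 680 * δ)
          + HypAct.Omega G X δ) :=
  ⟨fun _ _ _ hh hm helem => htame.isElementary_of_conj hacyl hX hlen hδ hnu hh hm helem,
    fun _ _ hgh => ⟨fun hg => htame.overlap_le_of_isShort hδ hX hlen hacyl hnu hgh hg,
      htame.overlap_pair_le hδ hX hlen hacyl hnu hgh⟩,
    fun _ hm g hg => htame.overlap_le hδ hX hlen hacyl hnu hm g hg⟩
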